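/- Let $S$ be a finite alphabet, $A\subseteq S\times S$ a transition relation, and let $\Sigma=\{\omega\in S^{\mathbb N}:(\omega_n,\omega_{n+1})\in A\ \forall n\ge 0\}$ be the corresponding one-sided topological Markov shift, assumed non-empty, with the metric $d(\omega,\omega')=2^{-\min\{n:\omega_n\neq\omega'_n\}}$ and the left shift $T:\Sigma\to\Sigma$. Let $X$ be a non-empty compact metric space. For $\omega\in\Sigma$ let $F_\omega:X\to X$ be an $\alpha$-Hölder homeomorphism (with $\alpha>0$ independent of $\omega$) such that $\omega\mapsto F_\omega$ is Hölder continuous for the uniform distance. Let $\{\phi_t\}_{t\in X}$ be an equi-Hölder family of functions $\phi_t:\Sigma\to\mathbb R$ (common exponent and constant) such that $t\mapsto\phi_t$ is Hölder continuous for the uniform norm. Put $$\widehat F(\omega,t)=(T\omega,F_\omega(t)),\qquad \widehat\phi(\omega,t)=\phi_t(\omega)\qquad((\omega,t)\in\Sigma\times X),$$ $$\widetilde\phi(\omega)=\limsup_{n\to\infty}\ \sup_{t\in X}\ \frac1n\sum_{k=0}^{n-1}\widehat\phi\big(\widehat F^k(\omega,t)\big)\qquad(\omega\in\Sigma),$$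 let $\pi:\Sigma\times X\to\Sigma$ be the projection, and let $h_\nu(T)$ denote the Kolmogorov–Sinai entropy of $T$ with respect to a $T$-invariant Borel probability measure $\nu$. Then $\widetilde\phi$ is integrable with respect to every ergodic $T$-invariant Borel probability measure, and $$\max\Big\{h_{\widehat\nu\circ\pi^{-1}}(T)+\int\widehat\phi\,d\widehat\nu\ :\ \widehat\nu\text{ an ergodic }\widehat F\text{-invariant Borel probability on }\Sigma\times X\Big\}$$ $$=\ \max\Big\{h_{\nu}(T)+\int\widetilde\phi\,d\nu\ :\ \nu\text{ an ergodic }T\text{-invariant Borel probability on }\Sigma\Big\},$$ where both maxima are attained and their common value is a real number. -/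

import Mathlib

open MeasureTheory Filter
open scoped NNReal

noncomputable section

/-- The one-sided topological Markov shift over the alphabet `S` with transition relation `A`:
all sequences of letters whose consecutive letters are admissible transitions. -/
def MarkovShift {S : Type*} (A : S → S → Prop) : Type _ :=
  {ω : ℕ → S // ∀ n, A (ω n) (ω (n + 1))}

namespace MarkovShift

variable {S : Type*} {A : S → S → Prop}

/-- The usual metric `d(ω, ω') = (1/2) ^ min {n | ωₙ ≠ ω'ₙ}` on the shift space. -/
instance instMetricSpace : MetricSpace (MarkovShift A) :=
  letI : TopologicalSpace S := ⊥
  haveI : DiscreteTopology S := ⟨rfl⟩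
  letI : MetricSpace (ℕ → S) := PiNat.metricSpace
  inferInstanceAs (MetricSpace {ω : ℕ → S // ∀ n, A (ω n) (ω (n + 1))})

instance instMeasurableSpace : MeasurableSpace (MarkovShift A) := borel _

instance instBorelSpace : BorelSpace (MarkovShift A) := ⟨rfl⟩

/-- The left shift. -/
def shift (ω : MarkovShift A) : MarkovShift A :=
  ⟨fun n => ω.1 (n + 1), fun n => ω.2 (n + 1)⟩

end MarkovShift

section Entropy

variable {Ω : Type*} [MeasurableSpace Ω]

/-- Shannon entropy `H_μ(ξ) = -∑ₐ μ(ξ = a) log μ(ξ = a)` of the finite partition of `Ω` into the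
level sets of `ξ`. -/
def partitionEntropy {ι : Type*} [Fintype ι] (μ : Measure Ω) (ξ : Ω → ι) : ℝ :=
  ∑ a, Real.negMulLog (μ.real (ξ ⁻¹' {a}))

/-- The itinerary map whose level sets are the atoms of `⋁_{i < n} T⁻ⁱ ξ`. -/
def itinerary {ι : Type*} (T : Ω → Ω) (ξ : Ω → ι) (n : ℕ) (x : Ω) : Fin n → ι :=
  fun i => ξ (T^[i] x)

/-- Entropy of `T` with respect to a finite partition: the linear growth rate of
`H_μ(⋁_{i < n} T⁻ⁱ ξ)`. -/
def entropyOfPartition {k : ℕ} (T : Ω → Ω) (μ : Measure Ω) (ξ : Ω → Fin k) : EReal :=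
  limsup (fun n : ℕ => ((partitionEntropy μ (itinerary T ξ n) / n : ℝ) : EReal)) atTop

/-- Kolmogorov–Sinai entropy `h_μ(T)`: the supremum over all finite measurable partitions. -/
def measureEntropy (T : Ω → Ω) (μ : Measure Ω) : EReal :=
  ⨆ (k : ℕ) (ξ : Ω → Fin k) (_ : Measurable ξ), entropyOfPartition T μ ξ

end Entropy

section SkewProduct

variable {S X : Type*} {A : S → S → Prop}

/-- The skew product `(ω, t) ↦ (Tω, F_ω(t))`. -/
def skewProduct (F : MarkovShift A → X → X) (p : MarkovShift A × X) : MarkovShift A × X :=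
  (p.1.shift, F p.1 p.2)

/-- The function `(ω, t) ↦ φ_t(ω)` on the product space. -/
def jointPotential (φ : X → MarkovShift A → ℝ) (p : MarkovShift A × X) : ℝ :=
  φ p.2 p.1

/-- The maximal asymptotic instability potential: the upper limit in `n` of the suprema over `t`
of the Birkhoff averages of the potential along the orbit of `(ω, t)`. -/
def maxInstability (F : MarkovShift A → X → X) (φ : X → MarkovShift A → ℝ)
    (ω : MarkovShift A) : ℝ :=
  limsup (fun n : ℕ => ⨆ t : X,
    birkhoffAverage ℝ (skewProduct F) (jointPotential φ) n (ω, t)) atTop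

end SkewProduct

end

/-!
Write `R` for the skew product, `π` for the projection to the base, `ψ` for the joint potential and
`ψ̃` for the maximal asymptotic instability. The inequality `∫ ψ dμ ≤ ∫ ψ̃ d(π μ)` for an
`R`-invariant `μ` follows from the maximal ergodic theorem: the upper limit of the Birkhoff averages
of a bounded function has at least the integral of the function. Conversely, every invariant `ν` on
the base lifts to an `R`-invariant `μ` with `∫ ψ dμ ≥ ∫ ψ̃ dν`. Indeed, let `q` be the sublinear
functional `q f = ∫ sup_t f (ω, t) dν(ω)`. By Hahn–Banach some linear functional lies below the
growth rate of `q` along the orbit sums and agrees with it at `ψ`; such a functional is given by an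
invariant measure over `ν`.

The entropy of a subshift is, by the Kolmogorov–Sinai generator theorem, the entropy rate of the
partition by the initial letter, which is upper semicontinuous and convex (even affine) in the
measure. Hence `μ ↦ h(π μ) + ∫ ψ dμ` attains its maximum over the invariant measures at an
extreme point, that is, at an ergodic measure, and its projection is a maximizer on the base.
-/

section Shannon

variable {ι κ : Type*}

theorem negMulLog_add_le {x y : ℝ} (hx : 0 ≤ x) (hy : 0 ≤ y) :
    Real.negMulLog (x + y) ≤ Real.negMulLog x + Real.negMulLog y := by
  rcases hx.eq_or_lt with rfl | hx
  · simp
  rcases hy.eq_or_lt with rfl | hy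
  · simp
  have hlogx : Real.log x ≤ Real.log (x + y) := Real.log_le_log hx (by linarith)
  have hlogy : Real.log y ≤ Real.log (x + y) := Real.log_le_log hy (by linarith)
  simp only [Real.negMulLog]
  nlinarith

theorem negMulLog_sum_le {p : ι → ℝ} (hp : ∀ i, 0 ≤ p i) (s : Finset ι) :
    Real.negMulLog (∑ i ∈ s, p i) ≤ ∑ i ∈ s, Real.negMulLog (p i) :=
  Finset.le_sum_of_subadditive_on_pred Real.negMulLog (0 ≤ ·) Real.negMulLog_zero.le
    (fun _ _ => negMulLog_add_le) (fun _ _ => add_nonneg) p fun i _ => hp i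

theorem mul_log_add_log_sub_log_sub_log_le {p q r s : ℝ} (hp : 0 ≤ p) (hq : p ≤ q) (hr : p ≤ r)
    (hs : q ≤ s) :
    p * (Real.log q + Real.log r - Real.log p - Real.log s) ≤ q * r / s - p := by
  rcases hp.eq_or_lt with rfl | hp
  · simpa using div_nonneg (mul_nonneg hq hr) (hq.trans hs)
  have hq' := hp.trans_le hq
  have hr' := hp.trans_le hr
  have hs' := hq'.trans_le hs
  have hlog : Real.log q + Real.log r - Real.log p - Real.log s = Real.log (q * r / (p * s)) := by
    rw [Real.log_div (by positivity) (by positivity), Real.log_mul hq'.ne' hr'.ne',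
      Real.log_mul hp.ne' hs'.ne', sub_sub]
  calc p * (Real.log q + Real.log r - Real.log p - Real.log s)
      ≤ p * (q * r / (p * s) - 1) := by
        rw [hlog]
        exact mul_le_mul_of_nonneg_left (Real.log_le_sub_one_of_pos (by positivity)) hp.le
    _ = q * r / s - p := by field_simp

variable [Fintype ι] [Fintype κ]

theorem sum_sum_negMulLog_add_negMulLog_sum_le {p : ι → κ → ℝ} (hp : ∀ a b, 0 ≤ p a b) :
    ∑ a, ∑ b, Real.negMulLog (p a b) + Real.negMulLog (∑ a, ∑ b, p a b) ≤
      ∑ a, Real.negMulLog (∑ b, p a b) + ∑ b, Real.negMulLog (∑ a, p a b) := by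
  set q : ι → ℝ := fun a => ∑ b, p a b
  set r : κ → ℝ := fun b => ∑ a, p a b
  set s : ℝ := ∑ a, q a
  have hpq (a b) : p a b ≤ q a :=
    Finset.single_le_sum (fun b _ => hp a b) (Finset.mem_univ b)
  have hpr (a b) : p a b ≤ r b :=
    Finset.single_le_sum (f := (p · b)) (fun a _ => hp a b) (Finset.mem_univ a)
  have hqs (a) : q a ≤ s :=
    Finset.single_le_sum (fun a _ => Finset.sum_nonneg fun b _ => hp a b) (Finset.mem_univ a)
  have hrs : ∑ b, r b = s := Finset.sum_comm
  have hsum : ∑ a, ∑ b, p a b * (Real.log (q a) + Real.log (r b) - Real.log (p a b) - Real.log s)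
      ≤ 0 := by
    calc _ ≤ ∑ a, ∑ b, (q a * r b / s - p a b) :=
          Finset.sum_le_sum fun a _ => Finset.sum_le_sum fun b _ =>
            mul_log_add_log_sub_log_sub_log_le (hp a b) (hpq a b) (hpr a b) (hqs a)
      _ = s * s / s - s := by
          simp_rw [Finset.sum_sub_distrib, ← Finset.sum_div, ← Finset.mul_sum, hrs,
            ← Finset.sum_mul]
          rfl
      _ = 0 := by rw [mul_self_div_self, sub_self]
  have hq : ∑ a, Real.negMulLog (q a) = -∑ a, ∑ b, p a b * Real.log (q a) := by
    simp_rw [← Finset.sum_mul, Real.negMulLog, neg_mul, Finset.sum_neg_distrib]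
    rfl
  have hr : ∑ b, Real.negMulLog (r b) = -∑ a, ∑ b, p a b * Real.log (r b) := by
    rw [Finset.sum_comm]
    simp_rw [← Finset.sum_mul, Real.negMulLog, neg_mul, Finset.sum_neg_distrib]
    rfl
  have hs : Real.negMulLog s = -∑ a, ∑ b, p a b * Real.log s := by
    simp_rw [← Finset.sum_mul, Real.negMulLog, neg_mul]
    rfl
  rw [hq, hr, hs]
  simp_rw [Real.negMulLog, mul_sub, mul_add, Finset.sum_sub_distrib, Finset.sum_add_distrib]
    at hsum ⊢
  simp_rw [neg_mul, Finset.sum_neg_distrib]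
  linarith

end Shannon

section PartitionEntropy

variable {Ω : Type*} [MeasurableSpace Ω] {ι κ τ : Type*}

theorem partitionEntropy_nonneg [Fintype ι] (μ : Measure Ω) [IsProbabilityMeasure μ] (ξ : Ω → ι) :
    0 ≤ partitionEntropy μ ξ :=
  Finset.sum_nonneg fun _ _ => Real.negMulLog_nonneg measureReal_nonneg measureReal_le_one

/-- The conditional entropy `H(ξ | ζ) = H(ζ, ξ) - H(ζ)` of the partition `ξ` given `ζ`. -/
noncomputable def condPartitionEntropy [Fintype ι] [Fintype τ] (μ : Measure Ω)
    (ξ : Ω → ι) (ζ : Ω → τ) : ℝ :=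
  partitionEntropy μ (fun x => (ζ x, ξ x)) - partitionEntropy μ ζ

variable [MeasurableSpace ι] [MeasurableSingletonClass ι] [MeasurableSpace κ]
  [MeasurableSingletonClass κ] [MeasurableSpace τ] [MeasurableSingletonClass τ]
  {ξ : Ω → ι} {η : Ω → κ} {ζ : Ω → τ}

theorem partitionEntropy_comp_of_measurePreserving [Fintype ι] {Ω' : Type*} [MeasurableSpace Ω']
    {μ : Measure Ω'} {ν : Measure Ω} {T : Ω' → Ω} (hT : MeasurePreserving T μ ν)
    (hξ : Measurable ξ) : partitionEntropy μ (fun x => ξ (T x)) = partitionEntropy ν ξ :=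
  Finset.sum_congr rfl fun a _ => congrArg Real.negMulLog <|
    hT.measureReal_preimage (hξ (measurableSet_singleton a)).nullMeasurableSet

theorem condPartitionEntropy_comp_of_measurePreserving [Fintype ι] [Fintype τ] {T : Ω → Ω}
    {μ : Measure Ω} (hT : MeasurePreserving T μ μ) (hξ : Measurable ξ) (hζ : Measurable ζ) :
    condPartitionEntropy μ (fun x => ξ (T x)) (fun x => ζ (T x)) = condPartitionEntropy μ ξ ζ := by
  rw [condPartitionEntropy, condPartitionEntropy,
    partitionEntropy_comp_of_measurePreserving hT hζ,
    partitionEntropy_comp_of_measurePreserving hT (hζ.prodMk hξ)]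

variable (μ : Measure Ω) [IsFiniteMeasure μ]

theorem sum_measureReal_preimage_prodMk [Fintype κ] (hξ : Measurable ξ) (hη : Measurable η)
    (a : ι) : ∑ b, μ.real ((fun x => (ξ x, η x)) ⁻¹' {(a, b)}) = μ.real (ξ ⁻¹' {a}) := by
  have h := sum_measureReal_preimage_singleton (μ := μ) ({a} ×ˢ Finset.univ)
    (f := fun x => (ξ x, η x)) fun c _ => (hξ.prodMk hη) (measurableSet_singleton c)
  rw [Finset.sum_product, Finset.sum_singleton] at h
  rw [h]
  congr 1
  ext
  simp [eq_comm]

theorem partitionEntropy_comp_le [Fintype ι] {κ : Type*} [Fintype κ] (hξ : Measurable ξ)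
    (f : ι → κ) : partitionEntropy μ (fun x => f (ξ x)) ≤ partitionEntropy μ ξ := by
  classical
  have hfiber (b : κ) : μ.real ((fun x => f (ξ x)) ⁻¹' {b}) =
      ∑ a with f a = b, μ.real (ξ ⁻¹' {a}) := by
    rw [sum_measureReal_preimage_singleton _ fun a _ => hξ (measurableSet_singleton a)]
    congr 1
    ext
    simp
  calc partitionEntropy μ (fun x => f (ξ x))
      ≤ ∑ b, ∑ a with f a = b, Real.negMulLog (μ.real (ξ ⁻¹' {a})) :=
        Finset.sum_le_sum fun b _ => by
          rw [hfiber]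
          exact negMulLog_sum_le (fun _ => measureReal_nonneg) _
    _ = partitionEntropy μ ξ := Finset.sum_fiberwise _ f _

variable [Fintype ι] [Fintype κ] [Fintype τ]

theorem partitionEntropy_submodular (hζ : Measurable ζ) (hξ : Measurable ξ) (hη : Measurable η) :
    partitionEntropy μ (fun x => (ζ x, ξ x, η x)) + partitionEntropy μ ζ ≤
      partitionEntropy μ (fun x => (ζ x, ξ x)) + partitionEntropy μ (fun x => (ζ x, η x)) := by
  set p : τ → ι → κ → ℝ := fun c a b => μ.real ((fun x => (ζ x, ξ x, η x)) ⁻¹' {(c, a, b)})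
  have hsum_η (c a) : ∑ b, p c a b = μ.real ((fun x => (ζ x, ξ x)) ⁻¹' {(c, a)}) := by
    rw [← sum_measureReal_preimage_prodMk μ (hζ.prodMk hξ) hη (c, a)]
    simp_rw [p, Set.preimage, Set.mem_singleton_iff, Prod.mk.injEq, and_assoc]
  have hsum_ξ (c b) : ∑ a, p c a b = μ.real ((fun x => (ζ x, η x)) ⁻¹' {(c, b)}) := by
    rw [← sum_measureReal_preimage_prodMk μ (hζ.prodMk hη) hξ (c, b)]
    simp_rw [p, Set.preimage, Set.mem_singleton_iff, Prod.mk.injEq, and_assoc, and_comm]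
  have hsum (c) : ∑ a, ∑ b, p c a b = μ.real (ζ ⁻¹' {c}) := by
    simp_rw [hsum_η, sum_measureReal_preimage_prodMk μ hζ hξ]
  have h := Finset.sum_le_sum fun c (_ : c ∈ Finset.univ) =>
    sum_sum_negMulLog_add_negMulLog_sum_le (p := p c) fun _ _ => measureReal_nonneg
  simp_rw [hsum, hsum_ξ, hsum_η, Finset.sum_add_distrib] at h
  simpa only [partitionEntropy, Fintype.sum_prod_type] using h

theorem partitionEntropy_le_add_condPartitionEntropy (hξ : Measurable ξ) (hζ : Measurable ζ) :
    partitionEntropy μ ξ ≤ partitionEntropy μ ζ + condPartitionEntropy μ ξ ζ := by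
  rw [condPartitionEntropy, add_sub_cancel]
  exact partitionEntropy_comp_le μ (hζ.prodMk hξ) Prod.snd

theorem condPartitionEntropy_prodMk_le (hξ : Measurable ξ) (hη : Measurable η)
    (hζ : Measurable ζ) :
    condPartitionEntropy μ (fun x => (ξ x, η x)) ζ ≤
      condPartitionEntropy μ ξ ζ + condPartitionEntropy μ η ζ := by
  have := partitionEntropy_submodular μ hζ hξ hη
  unfold condPartitionEntropy
  linarith

theorem condPartitionEntropy_comp_left_le {κ : Type*} [Fintype κ] (hξ : Measurable ξ)
    (hζ : Measurable ζ) (f : ι → κ) :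
    condPartitionEntropy μ (fun x => f (ξ x)) ζ ≤ condPartitionEntropy μ ξ ζ :=
  sub_le_sub_right (partitionEntropy_comp_le μ (hζ.prodMk hξ) fun c => (c.1, f c.2)) _

theorem condPartitionEntropy_le_comp_right (hξ : Measurable ξ) (hζ : Measurable ζ) (f : τ → κ) :
    condPartitionEntropy μ ξ ζ ≤ condPartitionEntropy μ ξ (fun x => f (ζ x)) := by
  have hfζ : Measurable fun x => f (ζ x) := (Measurable.of_discrete (f := f)).comp hζ
  have hsub := partitionEntropy_submodular μ hfζ hζ hξ
  have hpair := partitionEntropy_comp_le μ hζ fun c => (f c, c)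
  have htriple := partitionEntropy_comp_le μ (hfζ.prodMk (hζ.prodMk hξ)) Prod.snd
  unfold condPartitionEntropy
  linarith

theorem condPartitionEntropy_self (hξ : Measurable ξ) : condPartitionEntropy μ ξ ξ = 0 :=
  sub_eq_zero.2 <| (partitionEntropy_comp_le μ hξ fun c => (c, c)).antisymm
    (partitionEntropy_comp_le μ (hξ.prodMk hξ) Prod.fst)

theorem partitionEntropy_prodMk_le (ν : Measure Ω) [IsProbabilityMeasure ν] (hξ : Measurable ξ)
    (hη : Measurable η) :
    partitionEntropy ν (fun x => (ξ x, η x)) ≤ partitionEntropy ν ξ + partitionEntropy ν η := by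
  have hsub := partitionEntropy_submodular ν (measurable_const (a := ())) hξ hη
  have hξ' := partitionEntropy_comp_le ν hξ fun c => ((), c)
  have hη' := partitionEntropy_comp_le ν hη fun c => ((), c)
  have hpair := partitionEntropy_comp_le ν ((measurable_const (a := ())).prodMk (hξ.prodMk hη))
    Prod.snd
  have htriv := partitionEntropy_nonneg ν fun _ => ()
  linarith

end PartitionEntropy

section GrowthRate

/-- The linear growth rate `inf_{n ≥ 1} u n / n`. By Fekete's lemma it is the limit of `u n / n`
when `u` is subadditive; it is defined for all sequences so that it can be manipulated without
carrying subadditivity along. -/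
noncomputable def growthRate (u : ℕ → ℝ) : ℝ :=
  ⨅ n : Set.Ici (1 : ℕ), u n / (n : ℕ)

theorem growthRate_le_div {u : ℕ → ℝ} (hu : BddBelow (Set.range fun n => u n / n)) {n : ℕ}
    (hn : n ≠ 0) : growthRate u ≤ u n / n :=
  ciInf_le (f := fun n : Set.Ici (1 : ℕ) => u n / (n : ℕ))
    (hu.mono (Set.range_comp_subset_range Subtype.val fun n : ℕ => u n / n))
    ⟨n, Nat.one_le_iff_ne_zero.2 hn⟩

theorem le_growthRate {u : ℕ → ℝ} {c : ℝ} (h : ∀ n : ℕ, n ≠ 0 → c ≤ u n / n) :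
    c ≤ growthRate u :=
  le_ciInf fun n => h n (Nat.one_le_iff_ne_zero.1 n.2)

theorem tendsto_div_growthRate_of_subadditive {u : ℕ → ℝ} (h : Subadditive u)
    (hu : BddBelow (Set.range fun n => u n / n)) :
    Tendsto (fun n => u n / n) atTop (nhds (growthRate u)) := by
  have hlim : growthRate u = h.lim := by rw [Subadditive.lim, sInf_image', growthRate]
  exact hlim ▸ h.tendsto_lim hu

end GrowthRate

section Itinerary

variable {Ω : Type*} {ι κ τ : Type*} {T : Ω → Ω} {ξ : Ω → ι}

theorem itinerary_add (T : Ω → Ω) (ξ : Ω → ι) (m n : ℕ) :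
    itinerary T ξ (m + n) =
      fun x => Fin.append (itinerary T ξ m x) (itinerary T ξ n (T^[m] x)) := by
  funext x i
  refine Fin.addCases (fun j => ?_) (fun j => ?_) i
  · simp [itinerary]
  · simp [itinerary, ← Function.iterate_add_apply, add_comm]

theorem itinerary_succ (T : Ω → Ω) (ξ : Ω → ι) (n : ℕ) :
    itinerary T ξ (n + 1) =
      fun x => (Fin.snoc (itinerary T ξ n x) (ξ (T^[n] x)) : Fin (n + 1) → ι) := by
  funext x i
  refine Fin.lastCases ?_ (fun j => ?_) i <;> simp [itinerary]

variable [MeasurableSpace Ω] [MeasurableSpace ι] [MeasurableSpace κ]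

theorem measurable_itinerary (hT : Measurable T) (hξ : Measurable ξ) (n : ℕ) :
    Measurable (itinerary T ξ n) :=
  measurable_pi_lambda _ fun i => hξ.comp (hT.iterate i)

variable {μ : Measure Ω} {η : Ω → κ} {ζ : Ω → τ}
  [Fintype ι] [MeasurableSingletonClass ι] [Fintype κ] [MeasurableSingletonClass κ]
  [Fintype τ] [MeasurableSpace τ] [MeasurableSingletonClass τ]

theorem condPartitionEntropy_itinerary_le_sum [IsFiniteMeasure μ] (hT : Measurable T)
    (hξ : Measurable ξ) (hζ : Measurable ζ) (n : ℕ) :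
    condPartitionEntropy μ (itinerary T ξ n) ζ ≤
      ∑ i ∈ Finset.range n, condPartitionEntropy μ (fun x => ξ (T^[i] x)) ζ := by
  induction n with
  | zero =>
    have hzero : itinerary T ξ 0 = fun _ => Fin.elim0 := Subsingleton.elim _ _
    rw [Finset.sum_range_zero, hzero, condPartitionEntropy, sub_nonpos]
    exact partitionEntropy_comp_le μ hζ fun c => (c, Fin.elim0)
  | succ n ih =>
    have hn := measurable_itinerary hT hξ n
    have hlast : Measurable fun x => ξ (T^[n] x) := hξ.comp (hT.iterate n)
    rw [Finset.sum_range_succ, itinerary_succ]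
    calc _ ≤ condPartitionEntropy μ (fun x => (itinerary T ξ n x, ξ (T^[n] x))) ζ :=
          condPartitionEntropy_comp_left_le μ (hn.prodMk hlast) hζ
            fun c => (Fin.snoc c.1 c.2 : Fin (n + 1) → ι)
      _ ≤ _ := (condPartitionEntropy_prodMk_le μ hn hlast hζ).trans (by gcongr)

theorem condPartitionEntropy_comp_iterate_itinerary_le [IsFiniteMeasure μ]
    (hT : MeasurePreserving T μ μ) (hξ : Measurable ξ) (hη : Measurable η) {i n m : ℕ}
    (hi : i + m ≤ n) :
    condPartitionEntropy μ (fun x => η (T^[i] x)) (itinerary T ξ n) ≤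
      condPartitionEntropy μ η (itinerary T ξ m) := by
  have hm := measurable_itinerary hT.measurable hξ m
  have hwindow : (fun x (j : Fin m) => itinerary T ξ n x ⟨i + j, by lia⟩) =
      fun x => itinerary T ξ m (T^[i] x) := by
    funext x j
    simp [itinerary, ← Function.iterate_add_apply, add_comm]
  have hle := condPartitionEntropy_le_comp_right μ (hη.comp (hT.measurable.iterate i))
    (measurable_itinerary hT.measurable hξ n) fun w (j : Fin m) => w ⟨i + j, by lia⟩
  rw [hwindow] at hle
  exact hle.trans_eq (condPartitionEntropy_comp_of_measurePreserving (hT.iterate i) hη hm)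

theorem partitionEntropy_itinerary_le_add [IsFiniteMeasure μ] (hT : MeasurePreserving T μ μ)
    (hξ : Measurable ξ) (hη : Measurable η) (n m : ℕ) :
    partitionEntropy μ (itinerary T η n) ≤
      partitionEntropy μ (itinerary T ξ (n + m)) +
        n * condPartitionEntropy μ η (itinerary T ξ m) := by
  have hξ' := measurable_itinerary hT.measurable hξ (n + m)
  calc partitionEntropy μ (itinerary T η n)
      ≤ partitionEntropy μ (itinerary T ξ (n + m)) +
          condPartitionEntropy μ (itinerary T η n) (itinerary T ξ (n + m)) :=
        partitionEntropy_le_add_condPartitionEntropy μ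
          (measurable_itinerary hT.measurable hη n) hξ'
    _ ≤ partitionEntropy μ (itinerary T ξ (n + m)) + ∑ i ∈ Finset.range n,
          condPartitionEntropy μ (fun x => η (T^[i] x)) (itinerary T ξ (n + m)) := by
        gcongr
        exact condPartitionEntropy_itinerary_le_sum hT.measurable hη hξ' n
    _ ≤ partitionEntropy μ (itinerary T ξ (n + m)) + ∑ _i ∈ Finset.range n,
          condPartitionEntropy μ η (itinerary T ξ m) := by
        gcongr with i hi
        have := Finset.mem_range.1 hi
        exact condPartitionEntropy_comp_iterate_itinerary_le hT hξ hη (by lia)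
    _ = _ := by simp

theorem subadditive_partitionEntropy_itinerary [IsProbabilityMeasure μ]
    (hT : MeasurePreserving T μ μ) (hξ : Measurable ξ) :
    Subadditive fun n => partitionEntropy μ (itinerary T ξ n) := by
  intro m n
  have hm := measurable_itinerary hT.measurable hξ m
  have hn := measurable_itinerary hT.measurable hξ n
  have hn' := hn.comp (hT.measurable.iterate m)
  dsimp only
  rw [itinerary_add]
  calc _ ≤ partitionEntropy μ fun x => (itinerary T ξ m x, itinerary T ξ n (T^[m] x)) :=
        partitionEntropy_comp_le μ (hm.prodMk hn')
          fun c => (Fin.append c.1 c.2 : Fin (m + n) → ι)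
    _ ≤ _ := partitionEntropy_prodMk_le μ hm hn'
    _ = _ := by
        congr 1
        exact partitionEntropy_comp_of_measurePreserving (hT.iterate m) hn

end Itinerary

section EntropyRate

variable {Ω : Type*} [MeasurableSpace Ω] {ι κ : Type*} [Fintype ι] {T : Ω → Ω} {μ : Measure Ω}

/-- The real-valued entropy of `T` with respect to the partition `ξ`. It agrees with
`entropyOfPartition` for invariant `μ`, but labels need not lie in some `Fin k`, and being an
infimum it is upper semicontinuous as soon as the entropies at each finite time are. -/
noncomputable def entropyRate (μ : Measure Ω) (T : Ω → Ω) (ξ : Ω → ι) : ℝ :=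
  growthRate fun n => partitionEntropy μ (itinerary T ξ n)

variable [IsProbabilityMeasure μ]

theorem bddBelow_range_partitionEntropy_itinerary_div (ξ : Ω → ι) :
    BddBelow (Set.range fun n : ℕ => partitionEntropy μ (itinerary T ξ n) / n) := by
  refine ⟨0, ?_⟩
  rintro _ ⟨n, rfl⟩
  exact div_nonneg (partitionEntropy_nonneg μ _) n.cast_nonneg

theorem tendsto_entropyRate [MeasurableSpace ι] [MeasurableSingletonClass ι]
    (hT : MeasurePreserving T μ μ) {ξ : Ω → ι} (hξ : Measurable ξ) :
    Tendsto (fun n : ℕ => partitionEntropy μ (itinerary T ξ n) / n) atTop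
      (nhds (entropyRate μ T ξ)) :=
  tendsto_div_growthRate_of_subadditive (subadditive_partitionEntropy_itinerary hT hξ)
    (bddBelow_range_partitionEntropy_itinerary_div ξ)

theorem entropyRate_le_add_condPartitionEntropy [MeasurableSpace ι] [MeasurableSingletonClass ι]
    [Fintype κ] [MeasurableSpace κ] [MeasurableSingletonClass κ] (hT : MeasurePreserving T μ μ)
    {ξ : Ω → ι} {η : Ω → κ} (hξ : Measurable ξ) (hη : Measurable η) (m : ℕ) :
    entropyRate μ T η ≤ entropyRate μ T ξ + condPartitionEntropy μ η (itinerary T ξ m) := by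
  have hshift : Tendsto (fun n : ℕ => partitionEntropy μ (itinerary T ξ (n + m)) / n) atTop
      (nhds (entropyRate μ T ξ)) := by
    have hratio : Tendsto (fun n : ℕ => ((n + m : ℕ) : ℝ) / n) atTop (nhds 1) := by
      have := (tendsto_natCast_div_add_atTop (m : ℝ)).inv₀ one_ne_zero
      simpa using this
    have h := ((tendsto_entropyRate hT hξ).comp (tendsto_add_atTop_nat m)).mul hratio
    rw [mul_one] at h
    refine h.congr' ?_
    filter_upwards [eventually_ne_atTop 0] with n hn
    have : ((n + m : ℕ) : ℝ) ≠ 0 := by positivity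
    simp only [Function.comp_apply]
    field_simp
  refine le_of_tendsto_of_tendsto (tendsto_entropyRate hT hη) (hshift.add_const _) ?_
  filter_upwards [eventually_gt_atTop 0] with n hn
  rw [div_le_iff₀ (by positivity), add_mul, div_mul_cancel₀ _ (by positivity), mul_comm _ (n : ℝ)]
  exact partitionEntropy_itinerary_le_add hT hξ hη n m

end EntropyRate

section Generator

variable {Ω : Type*} {ι κ : Type*} {T : Ω → Ω}

/-- The algebra of sets determined by finitely many steps of the itinerary. -/
def itinerarySets (T : Ω → Ω) (ξ : Ω → ι) : Set (Set Ω) :=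
  {B | ∃ (m : ℕ) (s : Set (Fin m → ι)), B = itinerary T ξ m ⁻¹' s}

theorem isSetAlgebra_itinerarySets (T : Ω → Ω) (ξ : Ω → ι) :
    IsSetAlgebra (itinerarySets T ξ) where
  empty_mem := ⟨0, ∅, rfl⟩
  compl_mem := by
    rintro _ ⟨m, s, rfl⟩
    exact ⟨m, sᶜ, rfl⟩
  union_mem := by
    rintro _ _ ⟨m, s, rfl⟩ ⟨n, t, rfl⟩
    exact ⟨max m n, {w | (fun i : Fin m => w (Fin.castLE (le_max_left m n) i)) ∈ s} ∪
      {w | (fun i : Fin n => w (Fin.castLE (le_max_right m n) i)) ∈ t}, rfl⟩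

variable [mΩ : MeasurableSpace Ω] {μ : Measure Ω} {ξ : Ω → ι} [MeasurableSpace κ]
  [MeasurableSingletonClass κ] {η : Ω → κ}

theorem exists_measureReal_ne_comp_itinerary_lt [Finite κ] [IsProbabilityMeasure μ]
    (hgen : mΩ = MeasurableSpace.generateFrom (itinerarySets T ξ)) (hη : Measurable η) {ε : ℝ}
    (hε : 0 < ε) :
    ∃ (m : ℕ) (g : (Fin m → ι) → κ), μ.real {x | η x ≠ g (itinerary T ξ m x)} < ε := by
  cases nonempty_fintype κ
  have : Nonempty κ := ⟨η (nonempty_of_isProbabilityMeasure μ).some⟩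
  have happrox (a : κ) : ∃ (m : ℕ) (s : Set (Fin m → ι)),
      μ.real (symmDiff (η ⁻¹' {a}) (itinerary T ξ m ⁻¹' s)) < ε / Fintype.card κ := by
    obtain ⟨_, ⟨m, s, rfl⟩, h⟩ := (Measure.MeasureDense.of_generateFrom_isSetAlgebra_finite
      μ (isSetAlgebra_itinerarySets T ξ) hgen).approx _ (hη (measurableSet_singleton a))
      (measure_ne_top _ _) (ε / Fintype.card κ) (by positivity)
    exact ⟨m, s, ENNReal.toReal_lt_of_lt_ofReal h⟩
  choose M s hs using happrox
  have hM (a : κ) : M a ≤ Finset.univ.sup M := Finset.le_sup (Finset.mem_univ a)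
  -- The label `a` is recovered from its indicator `(a = ·)`, so `η` is guessed by decoding the
  -- family of approximate indicators.
  let decode : (κ → Prop) → κ := Function.invFun fun a b => a = b
  have hdecode : Function.LeftInverse decode fun a b => a = b :=
    Function.leftInverse_invFun fun a a' h => by simpa using congrFun h a'
  refine ⟨Finset.univ.sup M, fun w => decode fun a => (fun i => w (Fin.castLE (hM a) i)) ∈ s a, ?_⟩
  calc μ.real {x | η x ≠ decode fun a => itinerary T ξ (M a) x ∈ s a}
      ≤ μ.real (⋃ a, symmDiff (η ⁻¹' {a}) (itinerary T ξ (M a) ⁻¹' s a)) := by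
        refine measureReal_mono fun x hx => ?_
        by_contra hmem
        refine hx ((hdecode (η x)).symm.trans (congrArg decode (funext fun a => ?_)))
        have := fun h => hmem (Set.mem_iUnion.2 ⟨a, h⟩)
        rw [Set.mem_symmDiff, Set.mem_preimage, Set.mem_preimage, Set.mem_singleton_iff] at this
        exact propext (by tauto)
    _ ≤ ∑ a, μ.real (symmDiff (η ⁻¹' {a}) (itinerary T ξ (M a) ⁻¹' s a)) :=
        measureReal_iUnion_fintype_le _
    _ < ∑ _a : κ, ε / Fintype.card κ :=
        Finset.sum_lt_sum_of_nonempty Finset.univ_nonempty fun a _ => hs a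
    _ = ε := by
        rw [Finset.sum_const, Finset.card_univ, nsmul_eq_mul]
        field_simp

variable [Fintype κ]

theorem tendsto_partitionEntropy_of_tendsto_measureReal_ne [IsFiniteMeasure μ] {α : Type*}
    {l : Filter α} (hη : Measurable η) {ζ : α → Ω → κ} (hζ : ∀ j, Measurable (ζ j))
    (hlim : Tendsto (fun j => μ.real {x | ζ j x ≠ η x}) l (nhds 0)) :
    Tendsto (fun j => partitionEntropy μ (ζ j)) l (nhds (partitionEntropy μ η)) := by
  refine tendsto_finsetSum _ fun a _ => (Real.continuous_negMulLog.tendsto _).comp ?_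
  rw [tendsto_iff_norm_sub_tendsto_zero]
  refine squeeze_zero (fun _ => norm_nonneg _) (fun j => ?_) hlim
  refine (abs_measureReal_sub_le_measureReal_symmDiff
    (hζ j (measurableSet_singleton a)).nullMeasurableSet
    (hη (measurableSet_singleton a)).nullMeasurableSet).trans (measureReal_mono ?_)
  rintro x (⟨hx, hx'⟩ | ⟨hx, hx'⟩) he <;> exact hx' (by simpa [he] using hx)

theorem tendsto_condPartitionEntropy_of_tendsto_measureReal_ne [IsFiniteMeasure μ] {α : Type*}
    {l : Filter α} (hη : Measurable η) {ζ : α → Ω → κ} (hζ : ∀ j, Measurable (ζ j))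
    (hlim : Tendsto (fun j => μ.real {x | ζ j x ≠ η x}) l (nhds 0)) :
    Tendsto (fun j => condPartitionEntropy μ η (ζ j)) l (nhds 0) := by
  have hpair : Tendsto (fun j => partitionEntropy μ fun x => (ζ j x, η x)) l
      (nhds (partitionEntropy μ fun x => (η x, η x))) :=
    tendsto_partitionEntropy_of_tendsto_measureReal_ne (hη.prodMk hη)
      (fun j => (hζ j).prodMk hη) (by simpa using hlim)
  rw [← condPartitionEntropy_self μ hη]
  exact hpair.sub (tendsto_partitionEntropy_of_tendsto_measureReal_ne hη hζ hlim)

variable [Fintype ι] [MeasurableSpace ι] [MeasurableSingletonClass ι]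

theorem exists_condPartitionEntropy_itinerary_lt [IsProbabilityMeasure μ] (hT : Measurable T)
    (hξ : Measurable ξ) (hgen : mΩ = MeasurableSpace.generateFrom (itinerarySets T ξ))
    (hη : Measurable η) {ε : ℝ} (hε : 0 < ε) :
    ∃ m, condPartitionEntropy μ η (itinerary T ξ m) < ε := by
  have happrox (j : ℕ) : ∃ (m : ℕ) (g : (Fin m → ι) → κ),
      μ.real {x | η x ≠ g (itinerary T ξ m x)} < 1 / ((j : ℝ) + 1) :=
    exists_measureReal_ne_comp_itinerary_lt hgen hη (by positivity)
  choose m g hg using happrox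
  have hlim : Tendsto (fun j => condPartitionEntropy μ η fun x => g j (itinerary T ξ (m j) x))
      atTop (nhds 0) :=
    tendsto_condPartitionEntropy_of_tendsto_measureReal_ne hη
      (fun j => Measurable.of_discrete.comp (measurable_itinerary hT hξ (m j)))
      (squeeze_zero (fun _ => measureReal_nonneg) (fun j => by simpa only [ne_comm] using (hg j).le)
        tendsto_one_div_add_atTop_nhds_zero_nat)
  obtain ⟨j, hj⟩ := (hlim.eventually_lt_const hε).exists
  exact ⟨m j, (condPartitionEntropy_le_comp_right μ hη (measurable_itinerary hT hξ (m j))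
    (g j)).trans_lt hj⟩

variable [IsProbabilityMeasure μ]

theorem entropyRate_le_of_generator (hT : MeasurePreserving T μ μ) (hξ : Measurable ξ)
    (hgen : mΩ = MeasurableSpace.generateFrom (itinerarySets T ξ)) (hη : Measurable η) :
    entropyRate μ T η ≤ entropyRate μ T ξ := by
  refine le_of_forall_pos_le_add fun ε hε => ?_
  obtain ⟨m, hm⟩ := exists_condPartitionEntropy_itinerary_lt (μ := μ) hT.measurable hξ hgen hη hε
  exact (entropyRate_le_add_condPartitionEntropy hT hξ hη m).trans (by gcongr)

theorem entropyRate_comp_le {κ : Type*} [Fintype κ] [MeasurableSpace κ]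
    [MeasurableSingletonClass κ] (hT : MeasurePreserving T μ μ) (hξ : Measurable ξ) (f : ι → κ) :
    entropyRate μ T (fun x => f (ξ x)) ≤ entropyRate μ T ξ :=
  le_of_tendsto_of_tendsto' (tendsto_entropyRate hT (Measurable.of_discrete.comp hξ))
    (tendsto_entropyRate hT hξ) fun n => div_le_div_of_nonneg_right
      (partitionEntropy_comp_le μ (measurable_itinerary hT.measurable hξ n) fun w i => f (w i))
      n.cast_nonneg

theorem entropyOfPartition_eq_entropyRate (hT : MeasurePreserving T μ μ) {k : ℕ} {ξ : Ω → Fin k}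
    (hξ : Measurable ξ) : entropyOfPartition T μ ξ = entropyRate μ T ξ :=
  ((continuous_coe_real_ereal.tendsto _).comp (tendsto_entropyRate hT hξ)).limsup_eq

theorem measureEntropy_eq_entropyRate (hT : MeasurePreserving T μ μ) (hξ : Measurable ξ)
    (hgen : mΩ = MeasurableSpace.generateFrom (itinerarySets T ξ)) :
    measureEntropy T μ = entropyRate μ T ξ := by
  refine le_antisymm (iSup_le fun k => iSup₂_le fun η hη => ?_) ?_
  · rw [entropyOfPartition_eq_entropyRate hT hη]
    exact EReal.coe_le_coe_iff.2 (entropyRate_le_of_generator hT hξ hgen hη)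
  · let e := Fintype.equivFin ι
    have he : Measurable fun x => e (ξ x) := Measurable.of_discrete.comp hξ
    calc (entropyRate μ T ξ : EReal) ≤ entropyRate μ T fun x => e (ξ x) := by
          simpa using entropyRate_comp_le hT he e.symm
      _ = entropyOfPartition T μ fun x => e (ξ x) := (entropyOfPartition_eq_entropyRate hT he).symm
      _ ≤ measureEntropy T μ := le_iSup_of_le _ (le_iSup₂_of_le _ he le_rfl)

end Generator

section ConvexCombination

variable {Ω : Type*} [MeasurableSpace Ω] {ι : Type*} [Fintype ι] [MeasurableSpace ι]
  [MeasurableSingletonClass ι] {μ₁ μ₂ : Measure Ω} [IsProbabilityMeasure μ₁]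
  [IsProbabilityMeasure μ₂] {a b : ℝ≥0} {ξ : Ω → ι}

theorem partitionEntropy_convexComb_le (hξ : Measurable ξ) :
    partitionEntropy (a • μ₁ + b • μ₂) ξ ≤
      a * partitionEntropy μ₁ ξ + b * partitionEntropy μ₂ ξ +
        (Real.negMulLog a + Real.negMulLog b) := by
  have hterm (i) : Real.negMulLog ((a • μ₁ + b • μ₂).real (ξ ⁻¹' {i})) ≤
      (a * Real.negMulLog (μ₁.real (ξ ⁻¹' {i})) + b * Real.negMulLog (μ₂.real (ξ ⁻¹' {i}))) +
        (μ₁.real (ξ ⁻¹' {i}) * Real.negMulLog a + μ₂.real (ξ ⁻¹' {i}) * Real.negMulLog b) := by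
    rw [measureReal_add_apply, measureReal_nnreal_smul_apply, measureReal_nnreal_smul_apply]
    refine (negMulLog_add_le (by positivity) (by positivity)).trans_eq ?_
    rw [Real.negMulLog_mul, Real.negMulLog_mul]
    ring
  have hsum (μ : Measure Ω) [IsProbabilityMeasure μ] : ∑ i, μ.real (ξ ⁻¹' {i}) = 1 := by
    rw [sum_measureReal_preimage_singleton _ fun i _ => hξ (measurableSet_singleton i)]
    simp
  refine (Finset.sum_le_sum fun i _ => hterm i).trans_eq ?_
  simp_rw [Finset.sum_add_distrib, ← Finset.sum_mul, ← Finset.mul_sum, hsum, one_mul]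
  rfl

theorem entropyRate_convexComb_le (hab : a + b = 1) {T : Ω → Ω} (h₁ : MeasurePreserving T μ₁ μ₁)
    (h₂ : MeasurePreserving T μ₂ μ₂) (hξ : Measurable ξ) :
    entropyRate (a • μ₁ + b • μ₂) T ξ ≤ a * entropyRate μ₁ T ξ + b * entropyRate μ₂ T ξ := by
  have : IsProbabilityMeasure (a • μ₁ + b • μ₂) := ⟨by
    simpa only [Measure.coe_add, Pi.add_apply, Measure.coe_nnreal_smul_apply, measure_univ,
      mul_one] using mod_cast hab⟩
  have h : MeasurePreserving T (a • μ₁ + b • μ₂) (a • μ₁ + b • μ₂) :=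
    ⟨h₁.measurable, by
      rw [Measure.map_add _ _ h₁.measurable, Measure.map_smul, Measure.map_smul, h₁.map_eq,
        h₂.map_eq]⟩
  have hlim := (((tendsto_entropyRate h₁ hξ).const_mul (a : ℝ)).add
    ((tendsto_entropyRate h₂ hξ).const_mul (b : ℝ))).add
    ((tendsto_const_nhds (x := Real.negMulLog a + Real.negMulLog b)).div_atTop
      tendsto_natCast_atTop_atTop)
  rw [add_zero] at hlim
  refine le_of_tendsto_of_tendsto' (tendsto_entropyRate h hξ) hlim fun n => ?_
  calc _ ≤ (a * partitionEntropy μ₁ (itinerary T ξ n) + b * partitionEntropy μ₂ (itinerary T ξ n) +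
        (Real.negMulLog a + Real.negMulLog b)) / n := by
        gcongr
        exact partitionEntropy_convexComb_le (measurable_itinerary h₁.measurable hξ n)
    _ = _ := by ring

end ConvexCombination

section MaximalErgodic

variable {Ω : Type*} {T : Ω → Ω} {g L : Ω → ℝ}

/-- The maximum of the Birkhoff sums over all times up to `n`, including the time zero. -/
noncomputable def maxBirkhoffSum (T : Ω → Ω) (g : Ω → ℝ) : ℕ → Ω → ℝ
  | 0, _ => 0
  | n + 1, x => max 0 (g x + maxBirkhoffSum T g n (T x))

theorem maxBirkhoffSum_nonneg (T : Ω → Ω) (g : Ω → ℝ) (n : ℕ) (x : Ω) :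
    0 ≤ maxBirkhoffSum T g n x := by
  cases n
  · exact le_rfl
  · exact le_max_left _ _

theorem maxBirkhoffSum_le_succ (T : Ω → Ω) (g : Ω → ℝ) (n : ℕ) (x : Ω) :
    maxBirkhoffSum T g n x ≤ maxBirkhoffSum T g (n + 1) x := by
  induction n generalizing x with
  | zero => exact maxBirkhoffSum_nonneg T g 1 x
  | succ n ih => exact max_le_max_left 0 (add_le_add_right (ih (T x)) (g x))

theorem birkhoffSum_le_maxBirkhoffSum (T : Ω → Ω) (g : Ω → ℝ) {m n : ℕ} (hmn : m ≤ n) (x : Ω) :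
    birkhoffSum T g m x ≤ maxBirkhoffSum T g n x := by
  refine le_trans ?_ (monotone_nat_of_le_succ (maxBirkhoffSum_le_succ T g · x) hmn)
  clear hmn
  induction m generalizing x with
  | zero => simp [maxBirkhoffSum]
  | succ m ih =>
    rw [birkhoffSum_succ']
    exact le_max_of_le_right (add_le_add_right (ih (T x)) (g x))

theorem maxBirkhoffSum_sub_apply_le_indicator (T : Ω → Ω) (g : Ω → ℝ) (n : ℕ) (x : Ω) :
    maxBirkhoffSum T g n x - maxBirkhoffSum T g n (T x) ≤
      {y | 0 < maxBirkhoffSum T g n y}.indicator g x := by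
  by_cases hx : 0 < maxBirkhoffSum T g n x
  · -- The maximum is attained at a positive time, so its first summand can be split off.
    rw [Set.indicator_of_mem (by exact hx)]
    obtain _ | n := n
    · exact absurd hx (lt_irrefl _)
    · have hmax : maxBirkhoffSum T g (n + 1) x = g x + maxBirkhoffSum T g n (T x) :=
        max_eq_right_of_lt ((lt_max_iff.1 hx).resolve_left (lt_irrefl _))
      have := maxBirkhoffSum_le_succ T g n (T x)
      linarith
  · rw [Set.indicator_of_notMem (by exact hx)]
    have := maxBirkhoffSum_nonneg T g n (T x)
    linarith

variable [MeasurableSpace Ω] {μ : Measure Ω}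

theorem integrable_maxBirkhoffSum (hT : MeasurePreserving T μ μ) (hg : Integrable g μ) (n : ℕ) :
    Integrable (maxBirkhoffSum T g n) μ := by
  induction n with
  | zero => exact integrable_zero _ _ _
  | succ n ih => exact (integrable_zero _ _ _).sup (hg.add (hT.integrable_comp_of_integrable ih))

theorem nullMeasurableSet_maxBirkhoffSum_pos (hT : MeasurePreserving T μ μ)
    (hg : Integrable g μ) (n : ℕ) : NullMeasurableSet {x | 0 < maxBirkhoffSum T g n x} μ :=
  nullMeasurableSet_lt aemeasurable_const (integrable_maxBirkhoffSum hT hg n).aemeasurable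

theorem integral_indicator_maxBirkhoffSum_pos_nonneg (hT : MeasurePreserving T μ μ)
    (hg : Integrable g μ) (n : ℕ) :
    0 ≤ ∫ x, {y | 0 < maxBirkhoffSum T g n y}.indicator g x ∂μ := by
  have hM := integrable_maxBirkhoffSum hT hg n
  have hMT : Integrable (fun x => maxBirkhoffSum T g n (T x)) μ :=
    hT.integrable_comp_of_integrable hM
  have hinv : ∫ x, maxBirkhoffSum T g n (T x) ∂μ = ∫ x, maxBirkhoffSum T g n x ∂μ := by
    conv_rhs => rw [← hT.map_eq]
    exact (integral_map hT.aemeasurable (hT.map_eq.symm ▸ hM.aestronglyMeasurable)).symm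
  calc (0 : ℝ) = ∫ x, (maxBirkhoffSum T g n x - maxBirkhoffSum T g n (T x)) ∂μ := by
        rw [integral_sub hM hMT, hinv, sub_self]
    _ ≤ _ := integral_mono (hM.sub hMT)
        (hg.indicator₀ (nullMeasurableSet_maxBirkhoffSum_pos hT hg n))
        (maxBirkhoffSum_sub_apply_le_indicator T g n)

theorem integral_nonneg_of_ae_exists_birkhoffSum_pos (hT : MeasurePreserving T μ μ)
    (hg : Integrable g μ) (h : ∀ᵐ x ∂μ, ∃ n, 0 < birkhoffSum T g n x) : 0 ≤ ∫ x, g x ∂μ := by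
  have hlim : Tendsto (fun n => ∫ x, {y | 0 < maxBirkhoffSum T g n y}.indicator g x ∂μ) atTop
      (nhds (∫ x, g x ∂μ)) := by
    refine tendsto_integral_of_dominated_convergence (fun x => ‖g x‖)
      (fun n => hg.aestronglyMeasurable.indicator₀ (nullMeasurableSet_maxBirkhoffSum_pos hT hg n))
      hg.norm (fun n => ae_of_all _ fun x => norm_indicator_le_norm_self g x) ?_
    filter_upwards [h] with x ⟨m, hm⟩
    refine tendsto_const_nhds.congr' ?_
    filter_upwards [eventually_ge_atTop m] with n hn
    have hx : x ∈ {y | 0 < maxBirkhoffSum T g n y} :=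
      hm.trans_le (birkhoffSum_le_maxBirkhoffSum T g hn x)
    exact (Set.indicator_of_mem hx g).symm
  exact ge_of_tendsto' hlim fun n => integral_indicator_maxBirkhoffSum_pos_nonneg hT hg n

theorem integral_le_integral_of_ae_exists_lt_birkhoffAverage (hT : MeasurePreserving T μ μ)
    (hg : Integrable g μ) (hL : Integrable L μ) (hLT : L ∘ T = L)
    (h : ∀ᵐ x ∂μ, ∃ n, n ≠ 0 ∧ L x < birkhoffAverage ℝ T g n x) :
    ∫ x, L x ∂μ ≤ ∫ x, g x ∂μ := by
  rw [← sub_nonneg, ← integral_sub hg hL]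
  refine integral_nonneg_of_ae_exists_birkhoffSum_pos hT (hg.sub hL) ?_
  filter_upwards [h] with x ⟨n, hn, hx⟩
  refine ⟨n, ?_⟩
  have hn' : (0 : ℝ) < n := by positivity
  rw [birkhoffAverage, smul_eq_mul, lt_inv_mul_iff₀ hn'] at hx
  change 0 < birkhoffSum T (g - L) n x
  rw [birkhoffSum_sub, birkhoffSum_of_comp_eq hLT, Pi.smul_apply, nsmul_eq_mul]
  exact sub_pos.2 hx

end MaximalErgodic

section LimsupBirkhoffAverage

theorem isBoundedUnder_le_of_abs_le {u : ℕ → ℝ} {C : ℝ} (h : ∀ n, |u n| ≤ C) :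
    IsBoundedUnder (· ≤ ·) atTop u :=
  isBoundedUnder_of ⟨C, fun n => (abs_le.1 (h n)).2⟩

theorem isCoboundedUnder_le_of_abs_le {u : ℕ → ℝ} {C : ℝ} (h : ∀ n, |u n| ≤ C) :
    IsCoboundedUnder (· ≤ ·) atTop u :=
  IsBoundedUnder.isCoboundedUnder_le (isBoundedUnder_of ⟨-C, fun n => (abs_le.1 (h n)).1⟩)

theorem abs_limsup_le {u : ℕ → ℝ} {C : ℝ} (h : ∀ n, |u n| ≤ C) : |limsup u atTop| ≤ C :=
  abs_le.2 ⟨le_limsup_of_frequently_le (Frequently.of_forall fun n => (abs_le.1 (h n)).1)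
    (isBoundedUnder_le_of_abs_le h), limsup_le_of_le (isCoboundedUnder_le_of_abs_le h)
    (Eventually.of_forall fun n => (abs_le.1 (h n)).2)⟩

theorem limsup_le_limsup_of_le_add {u v e : ℕ → ℝ} {C : ℝ} (hu : ∀ n, |u n| ≤ C)
    (hv : ∀ n, |v n| ≤ C) (huv : ∀ n, u n ≤ v n + e n) (he : Tendsto e atTop (nhds 0)) :
    limsup u atTop ≤ limsup v atTop := by
  refine le_of_forall_gt_imp_ge_of_dense fun a ha => ?_
  obtain ⟨b, hb, hba⟩ := exists_between ha
  refine limsup_le_of_le (isCoboundedUnder_le_of_abs_le hu) ?_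
  filter_upwards [eventually_lt_of_limsup_lt hb (isBoundedUnder_le_of_abs_le hv),
    he.eventually_lt_const (sub_pos.2 hba)] with n hn hn'
  linarith [huv n]

variable {Ω : Type*} {T : Ω → Ω} {g : Ω → ℝ} {C : ℝ}

theorem abs_birkhoffAverage_le (hC : ∀ x, |g x| ≤ C) (n : ℕ) (x : Ω) :
    |birkhoffAverage ℝ T g n x| ≤ C := by
  have hC₀ : 0 ≤ C := (abs_nonneg _).trans (hC x)
  obtain rfl | hn := eq_or_ne n 0
  · simpa using hC₀
  have hn' : (0 : ℝ) < n := by positivity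
  rw [birkhoffAverage, smul_eq_mul, abs_mul, abs_of_pos (inv_pos.2 hn'), inv_mul_le_iff₀ hn']
  calc |birkhoffSum T g n x| ≤ ∑ k ∈ Finset.range n, |g (T^[k] x)| := Finset.abs_sum_le_sum_abs _ _
    _ ≤ ∑ _k ∈ Finset.range n, C := Finset.sum_le_sum fun _ _ => hC _
    _ = n * C := by simp

theorem limsup_birkhoffAverage_comp (T : Ω → Ω) (hC : ∀ x, |g x| ≤ C) :
    (fun x => limsup (birkhoffAverage ℝ T g · x) atTop) ∘ T =
      fun x => limsup (birkhoffAverage ℝ T g · x) atTop := by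
  have hbdd : Bornology.IsBounded (Set.range g) :=
    isBounded_iff_forall_norm_le.2 ⟨C, Set.forall_mem_range.2 hC⟩
  funext x
  have hsub := tendsto_birkhoffAverage_apply_sub_birkhoffAverage' ℝ hbdd T x
  have hx := abs_birkhoffAverage_le (T := T) hC (x := x)
  have hTx := abs_birkhoffAverage_le (T := T) hC (x := T x)
  exact le_antisymm
    (limsup_le_limsup_of_le_add hTx hx (fun n => (add_sub_cancel _ _).ge) hsub)
    (limsup_le_limsup_of_le_add hx hTx (fun n => (add_sub_cancel _ _).ge)
      (by simpa only [neg_sub, neg_zero] using hsub.neg))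

variable [MeasurableSpace Ω] {μ : Measure Ω} [IsProbabilityMeasure μ]

theorem measurable_birkhoffAverage (hT : Measurable T) (hg : Measurable g) (n : ℕ) :
    Measurable (birkhoffAverage ℝ T g n) :=
  (Finset.measurable_sum _ fun k _ => hg.comp (hT.iterate k)).const_smul (n : ℝ)⁻¹

theorem integrable_limsup_birkhoffAverage (hT : Measurable T) (hg : Measurable g)
    (hC : ∀ x, |g x| ≤ C) :
    Integrable (fun x => limsup (birkhoffAverage ℝ T g · x) atTop) μ :=
  .of_bound (Measurable.limsup fun n => measurable_birkhoffAverage hT hg n).aestronglyMeasurable C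
    (ae_of_all _ fun x => abs_limsup_le (abs_birkhoffAverage_le hC (x := x)))

theorem integral_limsup_birkhoffAverage_le (hT : MeasurePreserving T μ μ) (hg : Measurable g)
    (hC : ∀ x, |g x| ≤ C) :
    ∫ x, limsup (birkhoffAverage ℝ T g · x) atTop ∂μ ≤ ∫ x, g x ∂μ := by
  have hL := integrable_limsup_birkhoffAverage (μ := μ) hT.measurable hg hC
  have hLT := limsup_birkhoffAverage_comp T hC
  set L := fun x => limsup (birkhoffAverage ℝ T g · x) atTop
  refine le_of_forall_pos_le_add fun ε hε => ?_
  have hle : ∫ x, (L x - ε) ∂μ ≤ ∫ x, g x ∂μ := by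
    refine integral_le_integral_of_ae_exists_lt_birkhoffAverage hT
      (.of_bound hg.aestronglyMeasurable C (ae_of_all _ hC)) (hL.sub (integrable_const ε))
      (funext fun x => congrArg (· - ε) (congrFun hLT x)) (ae_of_all _ fun x => ?_)
    have hx := frequently_lt_of_lt_limsup
      (isCoboundedUnder_le_of_abs_le (abs_birkhoffAverage_le hC (x := x))) (sub_lt_self (L x) hε)
    exact ((eventually_ne_atTop 0).and_frequently hx).exists
  rw [integral_sub hL (integrable_const ε), integral_const, probReal_univ, one_smul] at hle
  linarith

theorem integral_le_integral_limsup_birkhoffAverage (hT : MeasurePreserving T μ μ)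
    (hg : Measurable g) (hC : ∀ x, |g x| ≤ C) :
    ∫ x, g x ∂μ ≤ ∫ x, limsup (birkhoffAverage ℝ T g · x) atTop ∂μ := by
  have hL := integrable_limsup_birkhoffAverage (μ := μ) hT.measurable hg hC
  have hLT := limsup_birkhoffAverage_comp T hC
  set L := fun x => limsup (birkhoffAverage ℝ T g · x) atTop
  have hgi : Integrable g μ := .of_bound hg.aestronglyMeasurable C (ae_of_all _ hC)
  refine le_of_forall_pos_le_add fun ε hε => ?_
  have hle : ∫ x, -(L x + ε) ∂μ ≤ ∫ x, -g x ∂μ := by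
    refine integral_le_integral_of_ae_exists_lt_birkhoffAverage hT hgi.neg
      (hL.add (integrable_const ε)).neg
      (funext fun x => congrArg (fun r => -(r + ε)) (congrFun hLT x)) (ae_of_all _ fun x => ?_)
    have hx := eventually_lt_of_limsup_lt (lt_add_of_pos_right (L x) hε)
      (isBoundedUnder_le_of_abs_le (abs_birkhoffAverage_le hC (x := x)))
    obtain ⟨n, hn, hn'⟩ := ((eventually_ne_atTop 0).and hx).exists
    refine ⟨n, hn, ?_⟩
    simpa [birkhoffAverage, birkhoffSum] using hn'
  rw [integral_neg, integral_neg, integral_add hL (integrable_const ε), integral_const,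
    probReal_univ, one_smul] at hle
  linarith

end LimsupBirkhoffAverage

section InvariantFunctional

variable {V : Type*} [AddCommGroup V] [Module ℝ V]

theorem map_pow_apply_le {U : V →ₗ[ℝ] V} {q : V → ℝ} (hU : ∀ v, q (U v) ≤ q v) (n : ℕ) (v : V) :
    q ((U ^ n) v) ≤ q v := by
  induction n with
  | zero => exact le_rfl
  | succ n ih =>
    rw [pow_succ', Module.End.mul_apply]
    exact (hU _).trans ih

/-- Sublinear functionals, the dominating functionals of the Hahn–Banach theorem. -/
structure IsSublinear (q : V → ℝ) : Prop where
  add_le : ∀ v w, q (v + w) ≤ q v + q w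
  smul_of_pos : ∀ c : ℝ, 0 < c → ∀ v, q (c • v) = c * q v

namespace IsSublinear

variable {q : V → ℝ} {U : V →ₗ[ℝ] V}

theorem map_zero (hq : IsSublinear q) : q 0 = 0 := by
  have := hq.smul_of_pos 2 two_pos 0
  rw [smul_zero] at this
  linarith

theorem neg_map_neg_le (hq : IsSublinear q) (v : V) : -q (-v) ≤ q v := by
  have := hq.add_le v (-v)
  rw [add_neg_cancel, hq.map_zero] at this
  linarith

theorem smul_map_le (hq : IsSublinear q) (c : ℝ) (v : V) : c * q v ≤ q (c • v) := by
  rcases lt_trichotomy c 0 with hc | rfl | hc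
  · have := hq.neg_map_neg_le (c • v)
    rw [← neg_smul, hq.smul_of_pos _ (neg_pos.2 hc)] at this
    linarith
  · rw [zero_mul, zero_smul, hq.map_zero]
  · exact (hq.smul_of_pos c hc v).ge

theorem exists_linear_le (hq : IsSublinear q) (v₀ : V) :
    ∃ Λ : V →ₗ[ℝ] ℝ, (∀ v, Λ v ≤ q v) ∧ Λ v₀ = q v₀ := by
  have hwd : ∀ c : ℝ, c • v₀ = 0 → c • q v₀ = 0 := by
    intro c hc
    obtain rfl | rfl := smul_eq_zero.1 hc
    · exact zero_smul ℝ _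
    · rw [hq.map_zero, smul_zero]
  obtain ⟨Λ, hext, hle⟩ := exists_extension_of_le_sublinear
    (LinearPMap.mkSpanSingleton' (σ := RingHom.id ℝ) v₀ (q v₀) hwd) q hq.smul_of_pos hq.add_le (by
      rintro ⟨_, hw⟩
      obtain ⟨c, rfl⟩ := Submodule.mem_span_singleton.1 hw
      exact (LinearPMap.mkSpanSingleton'_apply v₀ (q v₀) hwd c hw).trans_le (hq.smul_map_le c v₀))
  refine ⟨Λ, hle, (hext ⟨v₀, Submodule.mem_span_singleton_self v₀⟩).trans ?_⟩
  exact LinearPMap.mkSpanSingleton'_apply_self v₀ (q v₀) hwd _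

theorem subadditive_map_geom_sum (hq : IsSublinear q) (hU : ∀ v, q (U v) ≤ q v) (v : V) :
    Subadditive fun n => q ((∑ k ∈ Finset.range n, U ^ k) v) := by
  intro m n
  have hsplit : ∑ k ∈ Finset.range (m + n), U ^ k =
      ∑ k ∈ Finset.range m, U ^ k + U ^ m * ∑ k ∈ Finset.range n, U ^ k := by
    simp only [Finset.sum_range_add, pow_add, Finset.mul_sum]
  dsimp only
  rw [hsplit, LinearMap.add_apply, Module.End.mul_apply]
  exact (hq.add_le _ _).trans (add_le_add_right (map_pow_apply_le hU m _) _)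

theorem map_geom_sum_le (hq : IsSublinear q) (hU : ∀ v, q (U v) ≤ q v) (n : ℕ) (v : V) :
    q ((∑ k ∈ Finset.range n, U ^ k) v) ≤ n * q v := by
  induction n with
  | zero => simp [hq.map_zero]
  | succ n ih =>
    rw [Finset.sum_range_succ, LinearMap.add_apply, Nat.cast_succ, add_one_mul]
    exact (hq.add_le _ _).trans (add_le_add ih (map_pow_apply_le hU n v))

end IsSublinear

/-- The linear growth rate of a functional `q` along the partial orbit sums `∑ k < n, U ^ k v`. If
`q` is sublinear and does not increase under `U`, this is the largest sublinear functional below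
`q` whose dominated linear functionals are all `U`-invariant. -/
noncomputable def orbitGrowth (U : V →ₗ[ℝ] V) (q : V → ℝ) (v : V) : ℝ :=
  growthRate fun n => q ((∑ k ∈ Finset.range n, U ^ k) v)

namespace IsSublinear

variable {q : V → ℝ} {U : V →ₗ[ℝ] V}

theorem bddBelow_range_map_geom_sum_div (hq : IsSublinear q) (hU : ∀ v, q (U v) ≤ q v) (v : V) :
    BddBelow (Set.range fun n : ℕ => q ((∑ k ∈ Finset.range n, U ^ k) v) / n) := by
  refine ⟨-|q (-v)|, ?_⟩
  rintro _ ⟨n, rfl⟩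
  obtain rfl | hn := Nat.eq_zero_or_pos n
  · simp
  rw [le_div_iff₀ (by positivity)]
  have hneg := hq.neg_map_neg_le ((∑ k ∈ Finset.range n, U ^ k) v)
  rw [← map_neg] at hneg
  have hle := hq.map_geom_sum_le hU n (-v)
  have habs := mul_le_mul_of_nonneg_left (le_abs_self (q (-v))) n.cast_nonneg
  linarith

theorem tendsto_orbitGrowth (hq : IsSublinear q) (hU : ∀ v, q (U v) ≤ q v) (v : V) :
    Tendsto (fun n : ℕ => q ((∑ k ∈ Finset.range n, U ^ k) v) / n) atTop
      (nhds (orbitGrowth U q v)) :=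
  tendsto_div_growthRate_of_subadditive (hq.subadditive_map_geom_sum hU v)
    (hq.bddBelow_range_map_geom_sum_div hU v)

theorem isSublinear_orbitGrowth (hq : IsSublinear q) (hU : ∀ v, q (U v) ≤ q v) :
    IsSublinear (orbitGrowth U q) where
  add_le v w := by
    refine le_of_tendsto_of_tendsto' (hq.tendsto_orbitGrowth hU (v + w))
      ((hq.tendsto_orbitGrowth hU v).add (hq.tendsto_orbitGrowth hU w)) fun n => ?_
    rw [map_add, ← add_div]
    exact div_le_div_of_nonneg_right (hq.add_le _ _) n.cast_nonneg
  smul_of_pos c hc v := by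
    refine tendsto_nhds_unique (hq.tendsto_orbitGrowth hU (c • v))
      (((hq.tendsto_orbitGrowth hU v).const_mul c).congr fun n => ?_)
    rw [map_smul, hq.smul_of_pos c hc, mul_div_assoc]

theorem orbitGrowth_le (hq : IsSublinear q) (hU : ∀ v, q (U v) ≤ q v) (v : V) :
    orbitGrowth U q v ≤ q v := by
  simpa [orbitGrowth] using growthRate_le_div (hq.bddBelow_range_map_geom_sum_div hU v) one_ne_zero

theorem orbitGrowth_sub_apply_nonpos (hq : IsSublinear q) (hU : ∀ v, q (U v) ≤ q v) (v : V) :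
    orbitGrowth U q (v - U v) ≤ 0 := by
  have hzero : Tendsto (fun n : ℕ => (q v + q (-v)) / n) atTop (nhds 0) :=
    tendsto_const_nhds.div_atTop tendsto_natCast_atTop_atTop
  refine le_of_tendsto_of_tendsto' (hq.tendsto_orbitGrowth hU _) hzero fun n => ?_
  have htelescope : (∑ k ∈ Finset.range n, U ^ k) (v - U v) = v + (U ^ n) (-v) := by
    have := congrArg (· v) (geom_sum_mul_neg U n)
    simpa [sub_eq_add_neg] using this
  rw [htelescope]
  exact div_le_div_of_nonneg_right
    ((hq.add_le _ _).trans (add_le_add_right (map_pow_apply_le hU n (-v)) _)) n.cast_nonneg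

theorem exists_invariant_linear_le (hq : IsSublinear q) (hU : ∀ v, q (U v) ≤ q v) (v₀ : V) :
    ∃ Λ : V →ₗ[ℝ] ℝ, (∀ v, Λ v ≤ q v) ∧ (∀ v, Λ (U v) = Λ v) ∧ Λ v₀ = orbitGrowth U q v₀ := by
  obtain ⟨Λ, hle, hΛ⟩ := (hq.isSublinear_orbitGrowth hU).exists_linear_le v₀
  refine ⟨Λ, fun v => (hle v).trans (hq.orbitGrowth_le hU v), fun v => ?_, hΛ⟩
  have h₁ := (hle _).trans (hq.orbitGrowth_sub_apply_nonpos hU v)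
  have h₂ := (hle _).trans (hq.orbitGrowth_sub_apply_nonpos hU (-v))
  simp only [map_sub, map_neg] at h₁ h₂
  linarith

end IsSublinear

end InvariantFunctional

section InvariantMeasure

variable {Y : Type*} [TopologicalSpace Y]

/-- The Koopman operator `f ↦ f ∘ T` of a continuous map on the continuous functions. -/
def koopman (T : C(Y, Y)) : C(Y, ℝ) →ₗ[ℝ] C(Y, ℝ) :=
  (ContinuousMap.compRightAlgHom ℝ ℝ T).toLinearMap

theorem koopman_apply (T : C(Y, Y)) (f : C(Y, ℝ)) : koopman T f = f.comp T :=
  rfl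

theorem geom_sum_koopman_apply (T : C(Y, Y)) (f : C(Y, ℝ)) (n : ℕ) (y : Y) :
    (∑ k ∈ Finset.range n, koopman T ^ k) f y = birkhoffSum T f n y := by
  have hpow (k : ℕ) : (koopman T ^ k) f y = f (T^[k] y) := by
    induction k generalizing f with
    | zero => rfl
    | succ k ih =>
      rw [pow_succ, Module.End.mul_apply, ih, Function.iterate_succ_apply', koopman_apply,
        ContinuousMap.comp_apply]
  simp only [LinearMap.sum_apply, ContinuousMap.coe_sum, Finset.sum_apply, hpow, birkhoffSum]

variable [T2Space Y] [CompactSpace Y] [MeasurableSpace Y] [BorelSpace Y]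

open CompactlySupported in
theorem exists_isProbabilityMeasure_integral_eq (Λ : C(Y, ℝ) →ₗ[ℝ] ℝ)
    (hΛ : ∀ (f : C(Y, ℝ)) (c : ℝ), (∀ y, f y ≤ c) → Λ f ≤ c) :
    ∃ μ : Measure Y, IsProbabilityMeasure μ ∧ ∀ f : C(Y, ℝ), ∫ y, f y ∂μ = Λ f := by
  have hge (f : C(Y, ℝ)) (c : ℝ) (hf : ∀ y, c ≤ f y) : c ≤ Λ f := by
    have := hΛ (-f) (-c) fun y => neg_le_neg (hf y)
    rwa [map_neg, neg_le_neg_iff] at this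
  let Λc : C_c(Y, ℝ) →ₗ[ℝ] ℝ :=
    { toFun := fun f => Λ f.toContinuousMap
      map_add' := fun f g => Λ.map_add f.toContinuousMap g.toContinuousMap
      map_smul' := fun c f => Λ.map_smul c f.toContinuousMap }
  let Λpos : C_c(Y, ℝ) →ₚ[ℝ] ℝ := PositiveLinearMap.mk₀ Λc fun f hf => hge _ 0 hf
  have hint (f : C(Y, ℝ)) : ∫ y, f y ∂(RealRMK.rieszMeasure Λpos) = Λ f :=
    RealRMK.integral_rieszMeasure Λpos ⟨f, HasCompactSupport.of_compactSpace f⟩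
  refine ⟨RealRMK.rieszMeasure Λpos, ⟨?_⟩, hint⟩
  have hone : Λ 1 = 1 := le_antisymm (hΛ 1 1 fun _ => le_rfl) (hge 1 1 fun _ => le_rfl)
  have huniv : (RealRMK.rieszMeasure Λpos).real Set.univ = 1 := by
    simpa [hone] using hint 1
  exact (ENNReal.toReal_eq_one_iff _).1 huniv

variable [HasOuterApproxClosed Y] {T : C(Y, Y)} {q : C(Y, ℝ) → ℝ}

theorem exists_measurePreserving_integral_le (hq : IsSublinear q)
    (hq_le : ∀ (f : C(Y, ℝ)) (c : ℝ), (∀ y, f y ≤ c) → q f ≤ c)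
    (hT : ∀ f, q (f.comp T) ≤ q f) (f₀ : C(Y, ℝ)) :
    ∃ μ : Measure Y, IsProbabilityMeasure μ ∧ MeasurePreserving T μ μ ∧
      (∀ f : C(Y, ℝ), ∫ y, f y ∂μ ≤ q f) ∧ ∫ y, f₀ y ∂μ = orbitGrowth (koopman T) q f₀ := by
  obtain ⟨Λ, hΛq, hΛT, hΛ₀⟩ := hq.exists_invariant_linear_le (U := koopman T) hT f₀
  obtain ⟨μ, hμ, hμΛ⟩ := exists_isProbabilityMeasure_integral_eq Λ
    fun f c hf => (hΛq f).trans (hq_le f c hf)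
  have hTm := T.continuous.measurable
  have : IsProbabilityMeasure (μ.map T) := Measure.isProbabilityMeasure_map hTm.aemeasurable
  refine ⟨μ, hμ, ⟨hTm, ?_⟩, fun f => (hμΛ f).trans_le (hΛq f), (hμΛ f₀).trans hΛ₀⟩
  refine ext_of_forall_integral_eq_of_IsFiniteMeasure fun f => ?_
  rw [integral_map hTm.aemeasurable f.continuous.aestronglyMeasurable]
  exact (hμΛ (f.toContinuousMap.comp T)).trans ((hΛT _).trans (hμΛ f.toContinuousMap).symm)

theorem exists_measurePreserving [Nonempty Y] (T : C(Y, Y)) :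
    ∃ μ : Measure Y, IsProbabilityMeasure μ ∧ MeasurePreserving T μ μ := by
  have hbdd (f : C(Y, ℝ)) : BddAbove (Set.range f) := (isCompact_range f.continuous).bddAbove
  have hsup : IsSublinear fun f : C(Y, ℝ) => ⨆ y, f y :=
    ⟨fun f g => ciSup_le fun y => add_le_add (le_ciSup (hbdd f) y) (le_ciSup (hbdd g) y),
      fun c hc f => (Real.mul_iSup_of_nonneg hc.le f).symm⟩
  obtain ⟨μ, hμ, hinv, -⟩ := exists_measurePreserving_integral_le (T := T) hsup
    (fun f c hf => ciSup_le hf) (fun f => ciSup_le fun y => le_ciSup (hbdd f) (T y)) 0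
  exact ⟨μ, hμ, hinv⟩

end InvariantMeasure

section ErgodicMaximizer

variable {Y : Type*} [MeasurableSpace Y] {T : Y → Y}

theorem ergodic_of_forall_convexComb_eq_imp {μ : ProbabilityMeasure Y}
    (hμ : MeasurePreserving T (μ : Measure Y) μ)
    (h : ∀ μ₁ μ₂ : ProbabilityMeasure Y, MeasurePreserving T (μ₁ : Measure Y) μ₁ →
      MeasurePreserving T (μ₂ : Measure Y) μ₂ → ∀ a b : ℝ≥0, 0 < a → 0 < b → a + b = 1 →
      a • (μ₁ : Measure Y) + b • (μ₂ : Measure Y) = μ → μ₁ = μ) :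
    Ergodic T (μ : Measure Y) := by
  refine Ergodic.of_mem_extremePoints ⟨⟨hμ, inferInstance⟩, ?_⟩
  rintro μ₁ ⟨h₁, hp₁⟩ μ₂ ⟨h₂, hp₂⟩ ⟨a, b, ha, hb, hab, heq⟩
  lift a to ℝ≥0 using fun htop => by simp [htop] at hab
  lift b to ℝ≥0 using fun htop => by simp [htop] at hab
  exact congrArg Subtype.val (h ⟨μ₁, hp₁⟩ ⟨μ₂, hp₂⟩ h₁ h₂ a b (by exact_mod_cast ha)
    (by exact_mod_cast hb) (by exact_mod_cast hab) heq)

variable [TopologicalSpace Y] [BorelSpace Y]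

theorem integrable_of_continuous [CompactSpace Y] {f : Y → ℝ} (hf : Continuous f) (μ : Measure Y)
    [IsFiniteMeasure μ] : Integrable f μ :=
  hf.integrable_of_hasCompactSupport (.of_compactSpace f)

theorem integral_convexComb [CompactSpace Y] {f : Y → ℝ} (hf : Continuous f) (μ₁ μ₂ : Measure Y)
    [IsFiniteMeasure μ₁] [IsFiniteMeasure μ₂] (a b : ℝ≥0) :
    ∫ y, f y ∂(a • μ₁ + b • μ₂) = a * ∫ y, f y ∂μ₁ + b * ∫ y, f y ∂μ₂ := by
  rw [integral_add_measure (integrable_of_continuous hf μ₁).smul_measure_nnreal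
      (integrable_of_continuous hf μ₂).smul_measure_nnreal,
    integral_smul_nnreal_measure, integral_smul_nnreal_measure]
  rfl

variable [HasOuterApproxClosed Y]

theorem isClosed_setOf_measurePreserving (hT : Continuous T) :
    IsClosed {μ : ProbabilityMeasure Y | MeasurePreserving T (μ : Measure Y) μ} := by
  have hfixed : {μ : ProbabilityMeasure Y | MeasurePreserving T (μ : Measure Y) μ} =
      {μ : ProbabilityMeasure Y | μ.map hT.measurable.aemeasurable = μ} :=
    Set.ext fun μ => ⟨fun h => Subtype.ext h.map_eq,
      fun h => ⟨hT.measurable, congrArg Subtype.val h⟩⟩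
  rw [hfixed]
  exact isClosed_eq (ProbabilityMeasure.continuous_map hT) continuous_id

variable [CompactSpace Y] [T2Space Y]

theorem exists_extreme_probabilityMeasure {K : Set (ProbabilityMeasure Y)} (hK : IsClosed K)
    (hne : K.Nonempty) :
    ∃ μ ∈ K, ∀ μ₁ ∈ K, ∀ μ₂ ∈ K, ∀ a b : ℝ≥0, 0 < a → 0 < b → a + b = 1 →
      a • (μ₁ : Measure Y) + b • (μ₂ : Measure Y) = μ → μ₁ = μ := by
  -- Integration against continuous functions embeds `K` as a compact subset of a locally convex
  -- space, where the Krein–Milman theorem applies.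
  let Φ : ProbabilityMeasure Y → C(Y, ℝ) → ℝ := fun μ f => ∫ y, f y ∂(μ : Measure Y)
  have hΦ : Continuous Φ := continuous_pi fun f =>
    ProbabilityMeasure.continuous_integral_continuousMap f
  have hΦ_inj : Function.Injective Φ := fun μ ν h => ProbabilityMeasure.toMeasure_injective
    (ext_of_forall_integral_eq_of_IsFiniteMeasure fun f => congrFun h f.toContinuousMap)
  obtain ⟨_, ⟨μ, hμ, rfl⟩, hext⟩ := (hK.isCompact.image hΦ).extremePoints_nonempty (hne.image Φ)
  refine ⟨μ, hμ, fun μ₁ h₁ μ₂ h₂ a b ha hb hab heq => hΦ_inj ?_⟩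
  refine hext ⟨μ₁, h₁, rfl⟩ ⟨μ₂, h₂, rfl⟩ ⟨a, b, ha, hb, by exact_mod_cast hab, ?_⟩
  funext f
  change a * ∫ y, f y ∂(μ₁ : Measure Y) + b * ∫ y, f y ∂(μ₂ : Measure Y) = ∫ y, f y ∂(μ : Measure Y)
  rw [← heq, integral_convexComb f.continuous]

theorem exists_ergodic_isMaxOn [Nonempty Y] (hT : Continuous T) {G : ProbabilityMeasure Y → ℝ}
    (husc : UpperSemicontinuous G)
    (hconv : ∀ μ μ₁ μ₂ : ProbabilityMeasure Y, MeasurePreserving T (μ₁ : Measure Y) μ₁ →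
      MeasurePreserving T (μ₂ : Measure Y) μ₂ → ∀ a b : ℝ≥0, a + b = 1 →
      a • (μ₁ : Measure Y) + b • (μ₂ : Measure Y) = μ → G μ ≤ a * G μ₁ + b * G μ₂) :
    ∃ μ : ProbabilityMeasure Y, Ergodic T (μ : Measure Y) ∧
      IsMaxOn G {ν | MeasurePreserving T (ν : Measure Y) ν} μ := by
  have hM := isClosed_setOf_measurePreserving hT
  obtain ⟨μ₀, hμ₀, hμ₀T⟩ := exists_measurePreserving ⟨T, hT⟩
  obtain ⟨m, hmT, hmax⟩ :=
    (husc.upperSemicontinuousOn _).exists_isMaxOn ⟨⟨μ₀, hμ₀⟩, hμ₀T⟩ hM.isCompact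
  obtain ⟨μ, ⟨hμT, hmμ⟩, hext⟩ := exists_extreme_probabilityMeasure
    (hM.inter (husc.isClosed_preimage (G m))) ⟨m, hmT, le_refl (G m)⟩
  refine ⟨μ, ergodic_of_forall_convexComb_eq_imp hμT ?_,
    fun ν hν => le_trans (b := G m) (hmax hν) hmμ⟩
  -- By convexity of `G` the maximizing invariant measures form a face.
  intro μ₁ μ₂ h₁ h₂ a b ha hb hab heq
  have hle : G m ≤ a * G μ₁ + b * G μ₂ := le_trans hmμ (hconv μ μ₁ μ₂ h₁ h₂ a b hab heq)
  have hle₁ : G μ₁ ≤ G m := hmax h₁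
  have hle₂ : G μ₂ ≤ G m := hmax h₂
  have hsum : (a : ℝ) * G m + b * G m = G m := by
    rw [← add_mul, ← NNReal.coe_add, hab, NNReal.coe_one, one_mul]
  have hge₁ : G m ≤ G μ₁ := le_of_mul_le_mul_left
    (by linarith [mul_le_mul_of_nonneg_left hle₂ b.coe_nonneg]) (NNReal.coe_pos.2 ha)
  have hge₂ : G m ≤ G μ₂ := le_of_mul_le_mul_left
    (by linarith [mul_le_mul_of_nonneg_left hle₁ a.coe_nonneg]) (NNReal.coe_pos.2 hb)
  exact hext μ₁ ⟨h₁, hge₁⟩ μ₂ ⟨h₂, hge₂⟩ a b ha hb hab heq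

end ErgodicMaximizer

section SymbolicCoding

variable {Ω ι : Type*} [TopologicalSpace Ω] {T : Ω → Ω} {ξ : Ω → ι}

theorem isLocallyConstant_itinerary (hT : Continuous T) (hξ : IsLocallyConstant ξ) (n : ℕ) :
    IsLocallyConstant (itinerary T ξ n) := by
  let : TopologicalSpace ι := ⊥
  have : DiscreteTopology ι := ⟨rfl⟩
  exact (IsLocallyConstant.iff_continuous _).2
    (continuous_pi fun i => hξ.continuous.comp (hT.iterate i))

theorem isClosedEmbedding_coding [CompactSpace Ω] [TopologicalSpace ι] [DiscreteTopology ι]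
    (hT : Continuous T) (hξ : IsLocallyConstant ξ)
    (hinj : Function.Injective fun x (n : ℕ) => ξ (T^[n] x)) :
    Topology.IsClosedEmbedding fun x (n : ℕ) => ξ (T^[n] x) :=
  (continuous_pi fun n => hξ.continuous.comp (hT.iterate n)).isClosedEmbedding hinj

theorem measurable_of_isLocallyConstant [MeasurableSpace Ω] [OpensMeasurableSpace Ω]
    [MeasurableSpace ι] (hξ : IsLocallyConstant ξ) : Measurable ξ :=
  fun s _ => (hξ s).measurableSet

variable [mΩ : MeasurableSpace Ω] [BorelSpace Ω]

theorem measurableSpace_eq_generateFrom_itinerarySets [CompactSpace Ω] [Countable ι]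
    (hT : Continuous T) (hξ : IsLocallyConstant ξ)
    (hinj : Function.Injective fun x (n : ℕ) => ξ (T^[n] x)) :
    mΩ = MeasurableSpace.generateFrom (itinerarySets T ξ) := by
  apply le_antisymm
  · let : TopologicalSpace ι := ⊥
    have : DiscreteTopology ι := ⟨rfl⟩
    let : MeasurableSpace ι := ⊤
    have hcomap : mΩ = (borel (ℕ → ι)).comap fun x (n : ℕ) => ξ (T^[n] x) := by
      rw [← borel_comap, ← (isClosedEmbedding_coding hT hξ hinj).eq_induced]
      exact BorelSpace.measurable_eq
    rw [hcomap, ← BorelSpace.measurable_eq (α := ℕ → ι), ← measurable_iff_comap_le]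
    refine @measurable_pi_iff _ _ _ (MeasurableSpace.generateFrom (itinerarySets T ξ)) _ _ |>.2
      fun n t _ => MeasurableSpace.measurableSet_generateFrom ?_
    exact ⟨n + 1, {w | w (Fin.last n) ∈ t}, rfl⟩
  · refine MeasurableSpace.generateFrom_le ?_
    rintro _ ⟨m, s, rfl⟩
    exact (isLocallyConstant_itinerary hT hξ m s).measurableSet

theorem measureEntropy_eq_entropyRate_of_isLocallyConstant [CompactSpace Ω] [Fintype ι]
    (hT : Continuous T) (hξ : IsLocallyConstant ξ)
    (hinj : Function.Injective fun x (n : ℕ) => ξ (T^[n] x)) {μ : Measure Ω}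
    [IsProbabilityMeasure μ] (hμ : MeasurePreserving T μ μ) :
    measureEntropy T μ = entropyRate μ T ξ :=
  let : MeasurableSpace ι := ⊤
  measureEntropy_eq_entropyRate hμ (measurable_of_isLocallyConstant hξ)
    (measurableSpace_eq_generateFrom_itinerarySets hT hξ hinj)

variable [HasOuterApproxClosed Ω]

theorem continuous_measureReal_of_isClopen {B : Set Ω} (hB : IsClopen B) :
    Continuous fun μ : ProbabilityMeasure Ω => (μ : Measure Ω).real B := by
  refine continuous_iff_continuousAt.2 fun μ => ?_
  have hfrontier : μ (frontier B) = 0 := by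
    rw [hB.frontier_eq, ProbabilityMeasure.coeFn_empty]
  exact (NNReal.continuous_coe.tendsto _).comp
    (ProbabilityMeasure.tendsto_measure_of_null_frontier_of_tendsto tendsto_id hfrontier)

theorem continuous_partitionEntropy [Fintype ι] (hξ : IsLocallyConstant ξ) :
    Continuous fun μ : ProbabilityMeasure Ω => partitionEntropy (μ : Measure Ω) ξ :=
  continuous_finsetSum _ fun a _ => Real.continuous_negMulLog.comp
    (continuous_measureReal_of_isClopen (hξ.isClopen_fiber a))

theorem upperSemicontinuous_entropyRate [Fintype ι] (hT : Continuous T)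
    (hξ : IsLocallyConstant ξ) :
    UpperSemicontinuous fun μ : ProbabilityMeasure Ω => entropyRate (μ : Measure Ω) T ξ := by
  refine upperSemicontinuous_ciInf (fun μ => ?_) fun n => Continuous.upperSemicontinuous
    ((continuous_partitionEntropy (isLocallyConstant_itinerary hT hξ n)).div_const _)
  refine (bddBelow_range_partitionEntropy_itinerary_div (μ := (μ : Measure Ω)) (T := T) ξ).mono ?_
  rintro _ ⟨n, rfl⟩
  exact ⟨n, rfl⟩

end SymbolicCoding

section FiberSup

variable {Ω X : Type*}

/-- The supremum of a function on a product over the fibers of the first projection. -/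
noncomputable def fiberSup (f : Ω × X → ℝ) (ω : Ω) : ℝ :=
  ⨆ t, f (ω, t)

theorem abs_fiberSup_le [Nonempty X] {f : Ω × X → ℝ} {C : ℝ} (hC : ∀ p, |f p| ≤ C) (ω : Ω) :
    |fiberSup f ω| ≤ C :=
  abs_le.2 ⟨(abs_le.1 (hC (ω, Classical.arbitrary X))).1.trans (le_ciSup (f := fun t => f (ω, t))
      ⟨C, Set.forall_mem_range.2 fun t => (abs_le.1 (hC (ω, t))).2⟩ _),
    ciSup_le fun t => (abs_le.1 (hC (ω, t))).2⟩

variable [TopologicalSpace Ω] [TopologicalSpace X] [CompactSpace X]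

theorem le_fiberSup {f : Ω × X → ℝ} (hf : Continuous f) (p : Ω × X) : f p ≤ fiberSup f p.1 :=
  le_ciSup (f := fun t => f (p.1, t))
    (isCompact_range (hf.comp (Continuous.prodMk_right p.1))).bddAbove p.2

theorem continuous_fiberSup {f : Ω × X → ℝ} (hf : Continuous f) : Continuous (fiberSup f) := by
  have h := isCompact_univ.continuous_sSup (f := fun ω t => f (ω, t)) (K := (Set.univ : Set X)) hf
  simp only [Set.image_univ, sSup_range] at h
  exact h

end FiberSup

section BirkhoffAverage

variable {Y : Type*} {T : Y → Y} {f : Y → ℝ} {C : ℝ}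

theorem exists_abs_le_of_continuous [TopologicalSpace Y] [CompactSpace Y] (hf : Continuous f) :
    ∃ C, ∀ y, |f y| ≤ C := by
  obtain ⟨C, hC⟩ := (isCompact_range hf).isBounded.exists_norm_le
  exact ⟨C, fun y => hC _ ⟨y, rfl⟩⟩

theorem continuous_birkhoffAverage [TopologicalSpace Y] (hT : Continuous T) (hf : Continuous f)
    (n : ℕ) : Continuous (birkhoffAverage ℝ T f n) :=
  (continuous_finsetSum _ fun k _ => hf.comp (hT.iterate k)).const_smul (n : ℝ)⁻¹

theorem birkhoffSum_birkhoffSum (T : Y → Y) (f : Y → ℝ) (m n : ℕ) (y : Y) :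
    birkhoffSum T (birkhoffSum T f m) n y = ∑ j ∈ Finset.range m, birkhoffSum T f n (T^[j] y) := by
  simp only [birkhoffSum, ← Function.iterate_add_apply]
  rw [Finset.sum_comm]
  simp only [add_comm]

theorem birkhoffSum_le_birkhoffSum_iterate_add (hC : ∀ y, |f y| ≤ C) (n j : ℕ) (y : Y) :
    birkhoffSum T f n y ≤ birkhoffSum T f n (T^[j] y) + j * (2 * C) := by
  induction j with
  | zero => simp
  | succ j ih =>
    rw [Function.iterate_succ_apply']
    have hshift := birkhoffSum_apply_sub_birkhoffSum T f n (T^[j] y)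
    have hlast := abs_le.1 (hC (T^[n] (T^[j] y)))
    have hfirst := abs_le.1 (hC (T^[j] y))
    push_cast
    linarith

theorem mul_birkhoffSum_le_birkhoffSum_birkhoffSum_add (hC : ∀ y, |f y| ≤ C) (m n : ℕ) (y : Y) :
    m * birkhoffSum T f n y ≤ birkhoffSum T (birkhoffSum T f m) n y + m * (m * (2 * C)) := by
  have hC₀ : 0 ≤ C := (abs_nonneg _).trans (hC y)
  calc m * birkhoffSum T f n y
      = ∑ _j ∈ Finset.range m, birkhoffSum T f n y := by simp
    _ ≤ ∑ j ∈ Finset.range m, (birkhoffSum T f n (T^[j] y) + m * (2 * C)) := by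
        refine Finset.sum_le_sum fun j hj =>
          (birkhoffSum_le_birkhoffSum_iterate_add hC n j y).trans ?_
        have := (Finset.mem_range.1 hj).le
        gcongr
    _ = birkhoffSum T (birkhoffSum T f m) n y + m * (m * (2 * C)) := by
        simp [Finset.sum_add_distrib, birkhoffSum_birkhoffSum]

theorem birkhoffAverage_le_birkhoffAverage_birkhoffAverage_add (hC : ∀ y, |f y| ≤ C) {m : ℕ}
    (hm : m ≠ 0) (n : ℕ) (y : Y) :
    birkhoffAverage ℝ T f n y ≤
      birkhoffAverage ℝ T (birkhoffAverage ℝ T f m) n y + m * (2 * C) / n := by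
  obtain rfl | hn := eq_or_ne n 0
  · simp
  have hsum : birkhoffSum T (birkhoffAverage ℝ T f m) n y =
      (m : ℝ)⁻¹ * birkhoffSum T (birkhoffSum T f m) n y := by
    simp only [birkhoffSum, birkhoffAverage, smul_eq_mul, Finset.mul_sum]
  have hm' : (0 : ℝ) < m := by positivity
  have hn' : (0 : ℝ) < n := by positivity
  have hle := mul_birkhoffSum_le_birkhoffSum_birkhoffSum_add (T := T) hC m n y
  rw [birkhoffAverage, birkhoffAverage, hsum, smul_eq_mul, smul_eq_mul, ← div_eq_inv_mul,
    ← div_eq_inv_mul, ← div_eq_inv_mul, ← add_div, div_le_div_iff_of_pos_right hn',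
    ← mul_le_mul_iff_right₀ hm', mul_add, mul_div_cancel₀ _ hm'.ne']
  exact hle

theorem birkhoffAverage_le_birkhoffAverage_fiberSup {Ω X : Type*} [TopologicalSpace Ω]
    [TopologicalSpace X] [CompactSpace X] {T : Ω → Ω} {R : Ω × X → Ω × X}
    (hRT : Function.Semiconj Prod.fst R T) {f : Ω × X → ℝ} (hf : Continuous f) (n : ℕ)
    (p : Ω × X) :
    birkhoffAverage ℝ R f n p ≤ birkhoffAverage ℝ T (fiberSup f) n p.1 := by
  refine mul_le_mul_of_nonneg_left (Finset.sum_le_sum fun k _ => ?_) (by positivity)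
  rw [← (hRT.iterate_right k).eq p]
  exact le_fiberSup hf _

end BirkhoffAverage

section MaxFiberAverage

variable {Ω X : Type*} {T : Ω → Ω} {R : Ω × X → Ω × X} {ψ : Ω × X → ℝ}

/-- The upper limit of the fiberwise suprema of the Birkhoff averages of `ψ`. For a skew product
over the shift, this is the maximal asymptotic instability potential `maxInstability`. -/
noncomputable def maxFiberAverage (R : Ω × X → Ω × X) (ψ : Ω × X → ℝ) (ω : Ω) : ℝ :=
  limsup (fun n => fiberSup (birkhoffAverage ℝ R ψ n) ω) atTop

theorem abs_fiberSup_birkhoffAverage_le [Nonempty X] {C : ℝ} (hC : ∀ p, |ψ p| ≤ C) (n : ℕ)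
    (ω : Ω) : |fiberSup (birkhoffAverage ℝ R ψ n) ω| ≤ C :=
  abs_fiberSup_le (abs_birkhoffAverage_le hC n) ω

variable [TopologicalSpace Ω] [TopologicalSpace X] [CompactSpace X]

section Pointwise

variable [Nonempty X] {C : ℝ}

theorem limsup_birkhoffAverage_le_maxFiberAverage (hR : Continuous R) (hψ : Continuous ψ)
    (hC : ∀ p, |ψ p| ≤ C) (p : Ω × X) :
    limsup (birkhoffAverage ℝ R ψ · p) atTop ≤ maxFiberAverage R ψ p.1 :=
  limsup_le_limsup (.of_forall fun n => le_fiberSup (continuous_birkhoffAverage hR hψ n) p)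
    (isCoboundedUnder_le_of_abs_le (abs_birkhoffAverage_le hC · p))
    (isBoundedUnder_le_of_abs_le (abs_fiberSup_birkhoffAverage_le hC · p.1))

theorem maxFiberAverage_le_limsup_birkhoffAverage (hR : Continuous R)
    (hRT : Function.Semiconj Prod.fst R T) (hψ : Continuous ψ) (hC : ∀ p, |ψ p| ≤ C) {m : ℕ}
    (hm : m ≠ 0) (ω : Ω) :
    maxFiberAverage R ψ ω ≤
      limsup (birkhoffAverage ℝ T (fiberSup (birkhoffAverage ℝ R ψ m)) · ω) atTop :=
  limsup_le_limsup_of_le_add (abs_fiberSup_birkhoffAverage_le hC · ω)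
    (abs_birkhoffAverage_le (abs_fiberSup_birkhoffAverage_le hC m) · ω) (fun n => ciSup_le fun t =>
      (birkhoffAverage_le_birkhoffAverage_birkhoffAverage_add hC hm n (ω, t)).trans
        (add_le_add_left (birkhoffAverage_le_birkhoffAverage_fiberSup hRT
          (continuous_birkhoffAverage hR hψ m) n (ω, t)) _))
    (tendsto_const_nhds.div_atTop tendsto_natCast_atTop_atTop)

end Pointwise

variable [MeasurableSpace Ω] [BorelSpace Ω]

theorem measurable_maxFiberAverage (hR : Continuous R) (hψ : Continuous ψ) :
    Measurable (maxFiberAverage R ψ) :=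
  Measurable.limsup fun n => (continuous_fiberSup (continuous_birkhoffAverage hR hψ n)).measurable

variable [CompactSpace Ω]

theorem integrable_maxFiberAverage [Nonempty X] (hR : Continuous R) (hψ : Continuous ψ)
    (ν : Measure Ω) [IsFiniteMeasure ν] : Integrable (maxFiberAverage R ψ) ν := by
  obtain ⟨C, hC⟩ := exists_abs_le_of_continuous hψ
  exact .of_bound (measurable_maxFiberAverage hR hψ).aestronglyMeasurable C
    (ae_of_all _ fun ω => abs_limsup_le (abs_fiberSup_birkhoffAverage_le hC · ω))

theorem integral_maxFiberAverage_le_integral_fiberSup [Nonempty X] {ν : Measure Ω}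
    [IsProbabilityMeasure ν] (hν : MeasurePreserving T ν ν) (hR : Continuous R)
    (hRT : Function.Semiconj Prod.fst R T) (hψ : Continuous ψ) {m : ℕ} (hm : m ≠ 0) :
    ∫ ω, maxFiberAverage R ψ ω ∂ν ≤ ∫ ω, fiberSup (birkhoffAverage ℝ R ψ m) ω ∂ν := by
  obtain ⟨C, hC⟩ := exists_abs_le_of_continuous hψ
  have hm_meas : Measurable (fiberSup (birkhoffAverage ℝ R ψ m)) :=
    (continuous_fiberSup (continuous_birkhoffAverage hR hψ m)).measurable
  have hm_le := abs_fiberSup_birkhoffAverage_le (R := R) hC m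
  calc ∫ ω, maxFiberAverage R ψ ω ∂ν
      ≤ ∫ ω, limsup (birkhoffAverage ℝ T (fiberSup (birkhoffAverage ℝ R ψ m)) · ω) atTop ∂ν :=
        integral_mono (integrable_maxFiberAverage hR hψ ν)
          (integrable_limsup_birkhoffAverage hν.measurable hm_meas hm_le)
          (maxFiberAverage_le_limsup_birkhoffAverage hR hRT hψ hC hm)
    _ ≤ ∫ ω, fiberSup (birkhoffAverage ℝ R ψ m) ω ∂ν :=
        integral_limsup_birkhoffAverage_le hν hm_meas hm_le

variable [SecondCountableTopology Ω] [MeasurableSpace X] [BorelSpace X]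

theorem integral_le_integral_maxFiberAverage [Nonempty X] {μ : Measure (Ω × X)}
    [IsProbabilityMeasure μ] (hμ : MeasurePreserving R μ μ) (hR : Continuous R)
    (hψ : Continuous ψ) :
    ∫ p, ψ p ∂μ ≤ ∫ ω, maxFiberAverage R ψ ω ∂(μ.map Prod.fst) := by
  obtain ⟨C, hC⟩ := exists_abs_le_of_continuous hψ
  have : IsProbabilityMeasure (μ.map Prod.fst) :=
    Measure.isProbabilityMeasure_map measurable_fst.aemeasurable
  rw [integral_map measurable_fst.aemeasurable
    (measurable_maxFiberAverage hR hψ).aestronglyMeasurable]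
  calc ∫ p, ψ p ∂μ
      ≤ ∫ p, limsup (birkhoffAverage ℝ R ψ · p) atTop ∂μ :=
        integral_le_integral_limsup_birkhoffAverage hμ hψ.measurable hC
    _ ≤ ∫ p, maxFiberAverage R ψ p.1 ∂μ :=
        integral_mono (integrable_limsup_birkhoffAverage hμ.measurable hψ.measurable hC)
          ((integrable_maxFiberAverage hR hψ _).comp_measurable measurable_fst)
          (limsup_birkhoffAverage_le_maxFiberAverage hR hψ hC)

end MaxFiberAverage

section InvariantLift

variable {Ω X : Type*} [TopologicalSpace Ω] [MeasurableSpace Ω] [BorelSpace Ω]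
  [TopologicalSpace X] {ν : Measure Ω}

theorem map_fst_eq_of_integral_le_integral_fiberSup [HasOuterApproxClosed Ω] [MeasurableSpace X]
    [IsProbabilityMeasure ν] {μ : Measure (Ω × X)} [IsProbabilityMeasure μ]
    (h : ∀ f : C(Ω × X, ℝ), ∫ p, f p ∂μ ≤ ∫ ω, fiberSup f ω ∂ν) : μ.map Prod.fst = ν := by
  have : Nonempty X := (nonempty_of_isProbabilityMeasure μ).map Prod.snd
  have : IsProbabilityMeasure (μ.map Prod.fst) :=
    Measure.isProbabilityMeasure_map measurable_fst.aemeasurable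
  refine ext_of_forall_integral_eq_of_IsFiniteMeasure fun f => ?_
  have hle (g : C(Ω, ℝ)) : ∫ p, g p.1 ∂μ ≤ ∫ ω, g ω ∂ν := by
    simpa [fiberSup] using h (g.comp ContinuousMap.fst)
  have hneg := hle (-f.toContinuousMap)
  simp only [ContinuousMap.neg_apply, integral_neg, neg_le_neg_iff] at hneg
  rw [integral_map measurable_fst.aemeasurable f.continuous.aestronglyMeasurable]
  exact le_antisymm (hle f.toContinuousMap) hneg

variable [CompactSpace Ω] [CompactSpace X] {T : Ω → Ω} {R : Ω × X → Ω × X} {ψ : Ω × X → ℝ}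

theorem isSublinear_integral_fiberSup [Nonempty X] (ν : Measure Ω) [IsFiniteMeasure ν] :
    IsSublinear fun f : C(Ω × X, ℝ) => ∫ ω, fiberSup f ω ∂ν where
  add_le f g := by
    have hint (f : C(Ω × X, ℝ)) : Integrable (fiberSup f) ν :=
      integrable_of_continuous (continuous_fiberSup f.continuous) ν
    rw [← integral_add (hint f) (hint g)]
    exact integral_mono (hint (f + g)) ((hint f).add (hint g)) fun ω => ciSup_le fun t =>
      add_le_add (le_fiberSup f.continuous (ω, t)) (le_fiberSup g.continuous (ω, t))
  smul_of_pos c hc f := by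
    rw [← integral_const_mul]
    exact integral_congr_ae (ae_of_all _ fun ω => (Real.mul_iSup_of_nonneg hc.le _).symm)

theorem integral_fiberSup_le [Nonempty X] [IsProbabilityMeasure ν] {f : Ω × X → ℝ}
    (hf : Continuous f) {c : ℝ} (hc : ∀ p, f p ≤ c) : ∫ ω, fiberSup f ω ∂ν ≤ c :=
  (integral_mono (integrable_of_continuous (continuous_fiberSup hf) ν) (integrable_const c)
    fun ω => ciSup_le fun t => hc (ω, t)).trans_eq (by simp)

theorem integral_fiberSup_comp_le [Nonempty X] [IsFiniteMeasure ν] (hT : Continuous T)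
    (hν : MeasurePreserving T ν ν) (hR : Continuous R) (hRT : Function.Semiconj Prod.fst R T)
    {f : Ω × X → ℝ} (hf : Continuous f) :
    ∫ ω, fiberSup (f ∘ R) ω ∂ν ≤ ∫ ω, fiberSup f ω ∂ν := by
  have hsup := continuous_fiberSup hf
  calc ∫ ω, fiberSup (f ∘ R) ω ∂ν
      ≤ ∫ ω, fiberSup f (T ω) ∂ν :=
        integral_mono (integrable_of_continuous (continuous_fiberSup (hf.comp hR)) ν)
          (integrable_of_continuous (hsup.comp hT) ν) fun ω => ciSup_le fun t =>
            (le_fiberSup hf (R (ω, t))).trans_eq (by rw [hRT.eq])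
    _ = ∫ ω, fiberSup f ω ∂ν := by
        conv_rhs => rw [← hν.map_eq]
        exact (integral_map hν.measurable.aemeasurable hsup.aestronglyMeasurable).symm

theorem integral_maxFiberAverage_le_orbitGrowth [Nonempty X] [IsProbabilityMeasure ν]
    (hν : MeasurePreserving T ν ν) {R : C(Ω × X, Ω × X)} (hRT : Function.Semiconj Prod.fst R T)
    (ψ : C(Ω × X, ℝ)) :
    ∫ ω, maxFiberAverage R ψ ω ∂ν ≤
      orbitGrowth (koopman R) (fun f => ∫ ω, fiberSup f ω ∂ν) ψ := by
  refine le_growthRate fun n hn => ?_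
  refine (integral_maxFiberAverage_le_integral_fiberSup hν R.continuous hRT ψ.continuous
    hn).trans_eq ?_
  rw [div_eq_inv_mul, ← integral_const_mul]
  refine integral_congr_ae (ae_of_all _ fun ω => ?_)
  simp only [fiberSup, geom_sum_koopman_apply, birkhoffAverage, smul_eq_mul]
  exact (Real.mul_iSup_of_nonneg (by positivity) _).symm

variable [T2Space Ω] [SecondCountableTopology Ω] [T2Space X] [SecondCountableTopology X]
  [MeasurableSpace X] [BorelSpace X]

theorem exists_measurePreserving_map_fst_eq [Nonempty X] [IsProbabilityMeasure ν]
    (hT : Continuous T) (hν : MeasurePreserving T ν ν) (hR : Continuous R)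
    (hRT : Function.Semiconj Prod.fst R T) (hψ : Continuous ψ) :
    ∃ μ : Measure (Ω × X), IsProbabilityMeasure μ ∧ MeasurePreserving R μ μ ∧
      μ.map Prod.fst = ν ∧ ∫ ω, maxFiberAverage R ψ ω ∂ν ≤ ∫ p, ψ p ∂μ := by
  obtain ⟨μ, hμ, hμR, hle, hψμ⟩ := exists_measurePreserving_integral_le (T := ⟨R, hR⟩)
    (isSublinear_integral_fiberSup ν) (fun f _ hf => integral_fiberSup_le f.continuous hf)
    (fun f => integral_fiberSup_comp_le hT hν hR hRT f.continuous) ⟨ψ, hψ⟩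
  exact ⟨μ, hμ, hμR, map_fst_eq_of_integral_le_integral_fiberSup hle,
    (integral_maxFiberAverage_le_orbitGrowth hν (R := ⟨R, hR⟩) hRT ⟨ψ, hψ⟩).trans_eq hψμ.symm⟩

end InvariantLift

section RelativeVariationalPrinciple

variable {Ω X ι : Type*} [MeasurableSpace Ω] [MeasurableSpace X] [Fintype ι] {T : Ω → Ω}
  {R : Ω × X → Ω × X} {ψ : Ω × X → ℝ} {ξ : Ω → ι}

/-- The functional maximized over the invariant measures `μ` of a map over `T`: the entropy rate
of the first marginal of `μ` plus the integral of the potential `ψ`. Only the entropy of the base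
is counted, not that of the fibers. -/
noncomputable def baseFreeEnergy (T : Ω → Ω) (ξ : Ω → ι) (ψ : Ω × X → ℝ) (μ : Measure (Ω × X)) :
    ℝ :=
  entropyRate (μ.map Prod.fst) T ξ + ∫ p, ψ p ∂μ

theorem measurePreserving_map_fst (hT : Measurable T) (hRT : Function.Semiconj Prod.fst R T)
    {μ : Measure (Ω × X)} (hμ : MeasurePreserving R μ μ) :
    MeasurePreserving T (μ.map Prod.fst) (μ.map Prod.fst) :=
  (measurable_fst.measurePreserving μ).of_semiconj hμ hRT hT

variable [TopologicalSpace Ω] [CompactSpace Ω] [BorelSpace Ω] [SecondCountableTopology Ω]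
  [TopologicalSpace X] [CompactSpace X] [BorelSpace X]

theorem baseFreeEnergy_convexComb_le (hT : Continuous T) (hξ : IsLocallyConstant ξ)
    (hRT : Function.Semiconj Prod.fst R T) (hψ : Continuous ψ) {μ₁ μ₂ : Measure (Ω × X)}
    [IsProbabilityMeasure μ₁] [IsProbabilityMeasure μ₂] (h₁ : MeasurePreserving R μ₁ μ₁)
    (h₂ : MeasurePreserving R μ₂ μ₂) {a b : ℝ≥0} (hab : a + b = 1) :
    baseFreeEnergy T ξ ψ (a • μ₁ + b • μ₂) ≤
      a * baseFreeEnergy T ξ ψ μ₁ + b * baseFreeEnergy T ξ ψ μ₂ := by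
  let : MeasurableSpace ι := ⊤
  have (μ : Measure (Ω × X)) [IsProbabilityMeasure μ] : IsProbabilityMeasure (μ.map Prod.fst) :=
    Measure.isProbabilityMeasure_map measurable_fst.aemeasurable
  have hentropy := entropyRate_convexComb_le hab (measurePreserving_map_fst hT.measurable hRT h₁)
    (measurePreserving_map_fst hT.measurable hRT h₂)
    (measurable_of_isLocallyConstant hξ)
  rw [baseFreeEnergy, integral_convexComb hψ, Measure.map_add _ _ measurable_fst,
    Measure.map_smul, Measure.map_smul]
  unfold baseFreeEnergy
  linarith

variable [T2Space Ω] [SecondCountableTopology X]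

theorem upperSemicontinuous_baseFreeEnergy (hT : Continuous T) (hξ : IsLocallyConstant ξ)
    (hψ : Continuous ψ) :
    UpperSemicontinuous fun μ : ProbabilityMeasure (Ω × X) => baseFreeEnergy T ξ ψ μ :=
  ((upperSemicontinuous_entropyRate hT hξ).comp
    (ProbabilityMeasure.continuous_map continuous_fst)).add
    (ProbabilityMeasure.continuous_integral_continuousMap
      (⟨ψ, hψ⟩ : C(Ω × X, ℝ))).upperSemicontinuous

variable [T2Space X]

theorem exists_ergodic_baseFreeEnergy_le [Nonempty Ω] [Nonempty X] (hT : Continuous T)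
    (hξ : IsLocallyConstant ξ) (hR : Continuous R) (hRT : Function.Semiconj Prod.fst R T)
    (hψ : Continuous ψ) :
    ∃ μ : Measure (Ω × X), IsProbabilityMeasure μ ∧ Ergodic R μ ∧
      ∀ η : Measure (Ω × X), IsProbabilityMeasure η → MeasurePreserving R η η →
        baseFreeEnergy T ξ ψ η ≤ baseFreeEnergy T ξ ψ μ := by
  obtain ⟨μ, hμ, hmax⟩ := exists_ergodic_isMaxOn hR
    (upperSemicontinuous_baseFreeEnergy hT hξ hψ) fun _ _ _ h₁ h₂ _ _ hab heq =>
      heq ▸ baseFreeEnergy_convexComb_le hT hξ hRT hψ h₁ h₂ hab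
  exact ⟨μ, inferInstance, hμ, fun η hη hηR => hmax (a := ⟨η, hη⟩) hηR⟩

theorem entropyRate_add_integral_maxFiberAverage_le [Nonempty X] (hT : Continuous T)
    (hR : Continuous R) (hRT : Function.Semiconj Prod.fst R T) (hψ : Continuous ψ) {c : ℝ}
    (hc : ∀ η : Measure (Ω × X), IsProbabilityMeasure η → MeasurePreserving R η η →
      baseFreeEnergy T ξ ψ η ≤ c)
    {ν : Measure Ω} [IsProbabilityMeasure ν] (hν : MeasurePreserving T ν ν) :
    entropyRate ν T ξ + ∫ ω, maxFiberAverage R ψ ω ∂ν ≤ c := by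
  obtain ⟨η, hη, hηR, rfl, hle⟩ := exists_measurePreserving_map_fst_eq hT hν hR hRT hψ
  exact (add_le_add_right hle _).trans (hc η hη hηR)

end RelativeVariationalPrinciple

/-- By `hinj`, the system `(Ω, T)` is conjugate to a one-sided subshift over the alphabet `ι`. -/
theorem mainTheorem4_general {Ω X ι : Type*} [TopologicalSpace Ω] [CompactSpace Ω] [Nonempty Ω]
    [MeasurableSpace Ω] [BorelSpace Ω] [TopologicalSpace X] [CompactSpace X] [T2Space X]
    [SecondCountableTopology X] [Nonempty X] [MeasurableSpace X] [BorelSpace X] [Finite ι]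
    {T : Ω → Ω} (hT : Continuous T) {ξ : Ω → ι} (hξ : IsLocallyConstant ξ)
    (hinj : Function.Injective fun x (n : ℕ) => ξ (T^[n] x)) {R : Ω × X → Ω × X}
    (hR : Continuous R) (hRT : Function.Semiconj Prod.fst R T) {ψ : Ω × X → ℝ}
    (hψ : Continuous ψ) :
    (∀ ν : Measure Ω, IsFiniteMeasure ν → Integrable (maxFiberAverage R ψ) ν) ∧
    ∃ M : ℝ,
      IsGreatest {p : EReal | ∃ μ : Measure (Ω × X), IsProbabilityMeasure μ ∧ Ergodic R μ ∧
        p = measureEntropy T (μ.map Prod.fst) + ((∫ x, ψ x ∂μ : ℝ) : EReal)} (M : EReal) ∧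
      IsGreatest {p : EReal | ∃ ν : Measure Ω, IsProbabilityMeasure ν ∧ Ergodic T ν ∧
        p = measureEntropy T ν + ((∫ ω, maxFiberAverage R ψ ω ∂ν : ℝ) : EReal)} (M : EReal) := by
  refine ⟨fun ν _ => integrable_maxFiberAverage hR hψ ν, ?_⟩
  cases nonempty_fintype ι
  let : TopologicalSpace ι := ⊥
  have : DiscreteTopology ι := ⟨rfl⟩
  have : T2Space Ω := (isClosedEmbedding_coding hT hξ hinj).t2Space
  have : SecondCountableTopology Ω :=
    (isClosedEmbedding_coding hT hξ hinj).isEmbedding.secondCountableTopology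
  have hprob (η : Measure (Ω × X)) (_ : IsProbabilityMeasure η) :
      IsProbabilityMeasure (η.map Prod.fst) :=
    Measure.isProbabilityMeasure_map measurable_fst.aemeasurable
  obtain ⟨μ, hμ, hμR, hmax⟩ := exists_ergodic_baseFreeEnergy_le hT hξ hR hRT hψ
  have hfst (η : Measure (Ω × X)) (hη : IsProbabilityMeasure η) (hηR : Ergodic R η) :
      measureEntropy T (η.map Prod.fst) + ((∫ p, ψ p ∂η : ℝ) : EReal) =
        (baseFreeEnergy T ξ ψ η : EReal) := by
    have := hprob η hη
    rw [measureEntropy_eq_entropyRate_of_isLocallyConstant hT hξ hinj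
      (measurePreserving_map_fst hT.measurable hRT hηR.toMeasurePreserving), ← EReal.coe_add,
      baseFreeEnergy]
  have hbase (ν : Measure Ω) (hν : IsProbabilityMeasure ν) (hνT : Ergodic T ν) :
      measureEntropy T ν + ((∫ ω, maxFiberAverage R ψ ω ∂ν : ℝ) : EReal) ≤
        (baseFreeEnergy T ξ ψ μ : EReal) := by
    rw [measureEntropy_eq_entropyRate_of_isLocallyConstant hT hξ hinj hνT.toMeasurePreserving,
      ← EReal.coe_add, EReal.coe_le_coe_iff]
    exact entropyRate_add_integral_maxFiberAverage_le hT hR hRT hψ hmax hνT.toMeasurePreserving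
  have hmap : Ergodic T (μ.map Prod.fst) :=
    (measurable_fst.measurePreserving μ).ergodic_of_ergodic_semiconj hμR hT.measurable hRT
  refine ⟨baseFreeEnergy T ξ ψ μ, ⟨⟨μ, hμ, hμR, (hfst μ hμ hμR).symm⟩, ?_⟩,
    ⟨⟨μ.map Prod.fst, hprob μ hμ, hmap, le_antisymm ?_ (hbase _ (hprob μ hμ) hmap)⟩, ?_⟩⟩
  · rintro _ ⟨η, hη, hηR, rfl⟩
    rw [hfst η hη hηR, EReal.coe_le_coe_iff]
    exact hmax η hη hηR.toMeasurePreserving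
  · rw [← hfst μ hμ hμR]
    gcongr
    exact integral_le_integral_maxFiberAverage hμR.toMeasurePreserving hR hψ
  · rintro _ ⟨ν, hν, hνT, rfl⟩
    exact hbase ν hν hνT

namespace MarkovShift

variable {S : Type*} {A : S → S → Prop}

theorem isInducing_val [TopologicalSpace S] [DiscreteTopology S] :
    Topology.IsInducing fun ω : MarkovShift A => ω.1 := by
  constructor
  obtain rfl := DiscreteTopology.eq_bot (α := S)
  rfl

instance instCompactSpace [Finite S] : CompactSpace (MarkovShift A) := by
  let : TopologicalSpace S := ⊥
  have : DiscreteTopology S := ⟨rfl⟩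
  have hclosed : IsClosed {ω : ℕ → S | ∀ n, A (ω n) (ω (n + 1))} := by
    simp only [Set.ofPred_forall]
    exact isClosed_iInter fun n => (isClosed_discrete {p : S × S | A p.1 p.2}).preimage
      (f := fun ω : ℕ → S => (ω n, ω (n + 1))) (by fun_prop)
  rw [← isCompact_univ_iff, isInducing_val.isCompact_iff, Set.image_univ]
  exact Subtype.range_val ▸ hclosed.isCompact

theorem continuous_shift : Continuous (shift : MarkovShift A → MarkovShift A) := by
  let : TopologicalSpace S := ⊥
  have : DiscreteTopology S := ⟨rfl⟩
  exact isInducing_val.continuous_iff.2 <|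
    continuous_pi fun n => (continuous_apply (n + 1)).comp isInducing_val.continuous

theorem isLocallyConstant_eval_zero : IsLocallyConstant fun ω : MarkovShift A => ω.1 0 := by
  let : TopologicalSpace S := ⊥
  have : DiscreteTopology S := ⟨rfl⟩
  exact (IsLocallyConstant.iff_continuous _).2
    ((continuous_apply 0).comp isInducing_val.continuous)

theorem iterate_shift_val (n k : ℕ) (ω : MarkovShift A) : (shift^[n] ω).1 k = ω.1 (k + n) := by
  induction n generalizing ω with
  | zero => rfl
  | succ n ih => rw [Function.iterate_succ_apply, ih]; rfl

theorem injective_eval_zero_iterate_shift :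
    Function.Injective fun (ω : MarkovShift A) (n : ℕ) => (shift^[n] ω).1 0 := by
  simp only [iterate_shift_val, zero_add]
  exact Subtype.val_injective

theorem continuous_skewProduct {X : Type*} [TopologicalSpace X] {F : MarkovShift A → X → X}
    (hF : Continuous fun p : MarkovShift A × X => F p.1 p.2) : Continuous (skewProduct F) :=
  (continuous_shift.comp continuous_fst).prodMk hF

end MarkovShift

theorem continuous_uncurry_of_holderWith {Ω X Z : Type*} [PseudoEMetricSpace Ω]
    [TopologicalSpace X] [PseudoEMetricSpace Z] {f : Ω → X → Z} (hf : ∀ ω, Continuous (f ω))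
    {C β : ℝ≥0} (hβ : 0 < β) (hH : ∀ t, HolderWith C β fun ω => f ω t) :
    Continuous fun p : Ω × X => f p.1 p.2 := by
  refine continuous_iff_continuousAt.2 fun ⟨ω₀, t₀⟩ => ?_
  rw [ContinuousAt, tendsto_iff_edist_tendsto_0]
  have hbound : Continuous fun p : Ω × X =>
      C * edist p.1 ω₀ ^ (β : ℝ) + edist (f ω₀ p.2) (f ω₀ t₀) :=
    ((ENNReal.continuous_const_mul ENNReal.coe_ne_top).comp
      (ENNReal.continuous_rpow_const.comp (continuous_fst.edist continuous_const))).add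
      (((hf ω₀).comp continuous_snd).edist continuous_const)
  have htendsto := hbound.tendsto (ω₀, t₀)
  rw [edist_self, edist_self, ENNReal.zero_rpow_of_pos (NNReal.coe_pos.2 hβ), mul_zero,
    add_zero] at htendsto
  refine tendsto_of_tendsto_of_tendsto_of_le_of_le tendsto_const_nhds htendsto
    (fun _ => zero_le) fun p => ?_
  exact (edist_triangle _ (f ω₀ p.2) _).trans (add_le_add_left (hH p.2 p.1 ω₀) _)

theorem mainTheorem4 {S : Type*} [Finite S] (A : S → S → Prop) [Nonempty (MarkovShift A)]
    {X : Type*} [MetricSpace X] [CompactSpace X] [Nonempty X]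
    [MeasurableSpace X] [BorelSpace X]
    (F : MarkovShift A → X ≃ₜ X) (φ : X → MarkovShift A → ℝ)
    -- every `F_ω` is an `α`-Hölder homeomorphism
    (α : ℝ≥0) (hα : 0 < α) (hF : ∀ ω, ∃ C, HolderWith C α (F ω))
    -- `ω ↦ F_ω` is Hölder continuous for the uniform distance
    (CF β : ℝ≥0) (hβ : 0 < β) (hFω : ∀ t, HolderWith CF β (fun ω => F ω t))
    -- the potentials `φ_t` are equi-Hölder on the shift space
    (Cφ γ : ℝ≥0) (hγ : 0 < γ) (hφ : ∀ t, HolderWith Cφ γ (φ t))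
    -- `t ↦ φ_t` is Hölder continuous for the uniform distance
    (Cφ' δ : ℝ≥0) (hδ : 0 < δ) (hφt : ∀ ω, HolderWith Cφ' δ (fun t => φ t ω)) :
    (∀ ν : Measure (MarkovShift A), IsProbabilityMeasure ν → Ergodic MarkovShift.shift ν →
      Integrable (maxInstability (fun ω => F ω) φ) ν) ∧
    ∃ M : ℝ,
      IsGreatest {p : EReal | ∃ νhat : Measure (MarkovShift A × X),
        IsProbabilityMeasure νhat ∧ Ergodic (skewProduct (fun ω => F ω)) νhat ∧
        p = measureEntropy MarkovShift.shift (νhat.map Prod.fst) +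
          ((∫ x, jointPotential φ x ∂νhat : ℝ) : EReal)} (M : EReal) ∧
      IsGreatest {p : EReal | ∃ ν : Measure (MarkovShift A),
        IsProbabilityMeasure ν ∧ Ergodic MarkovShift.shift ν ∧
        p = measureEntropy MarkovShift.shift ν +
          ((∫ ω, maxInstability (fun ω => F ω) φ ω ∂ν : ℝ) : EReal)} (M : EReal) := by
  have hFc : Continuous fun p : MarkovShift A × X => F p.1 p.2 :=
    continuous_uncurry_of_holderWith (fun ω => (F ω).continuous) hβ hFω
  have hφc : Continuous (jointPotential φ) :=
    continuous_uncurry_of_holderWith (f := fun ω t => φ t ω)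
      (fun ω => (hφt ω).continuous hδ) hγ hφ
  have hmain := mainTheorem4_general MarkovShift.continuous_shift
    MarkovShift.isLocallyConstant_eval_zero MarkovShift.injective_eval_zero_iterate_shift
    (MarkovShift.continuous_skewProduct (F := fun ω => F ω) hFc) (fun _ => rfl) hφc
  exact ⟨fun ν _ _ => hmain.1 ν inferInstance, hmain.2⟩
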